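/- Let $n\ge 1$, $\alpha>0$, $1<p<n/\alpha$, and put $d=n-\alpha p>0$. Write $X\prec Y$ if $X\le cY$ for a finite constant $c$, and $X\approx Y$ if $X\prec Y$ and $Y\prec X$. Let $\Phi:[0,\infty)\to[0,\infty)$ satisfy: 1. there is a strictly increasing $\widetilde\Phi:[0,\infty)\to[0,\infty)$ with $\Phi\approx\widetilde\Phi$ on $[0,\infty)$; 2. $\Phi(0)=0$, and for every $c>0$, $\Phi(cs)\approx\Phi(s)$ uniformly in $s$ (with constants that may depend on $c$); 3. uniformly for all $s>0$, $$\int_0^s\Big[\frac{\Phi(u)}{u^{n-\alpha p}}\Big]^{1/p}\frac{du}{u}\prec\Big[\frac{\Phi(s)}{s^{n-\alpha p}}\Big]^{1/p}.$$ For an open set $O\subset\mathbb R^n$ let $TO=\{(x,t): x\in O,\ 0<t<\operatorname{dist}(x,\partial O)\}$ be the tent over $O$ (with $\operatorname{dist}(x,\emptyset)=\infty$). Let $$\Lambda^\infty_d(O)=\inf\sum_j r_j^d$$ be the $d$-dimensional Hausdorff capacity, the infimum being over all countable covers of $O$ by balls of radii $r_j$, and let $$cap(O;h^\alpha_p)=\inf\{\|f\|_{h^\alpha_p}^p:\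 f\in\mathcal S(\mathbb R^n),\ f\ge 0,\ f\ge 1\text{ on }O\}\qquad(\inf\emptyset=\infty)$$ be the Riesz capacity, where $\|f\|_{h^\alpha_p}=\|g\|_{L^p}$ if $f=R^\alpha g$ a.e. with $g\in L^p(\mathbb R^n)$ (and $\infty$ if there is no such $g$), and $$R^\alpha g(x)=c(\alpha,n)\int_{\mathbb R^n}|x-y|^{\alpha-n}g(y)\,dy,\qquad c(\alpha,n)=\frac{\Gamma((n-\alpha)/2)}{\pi^{n/2}\,2^\alpha\,\Gamma(\alpha/2)}.$$ For positive Borel measures $\mu$ on $\mathbb R^n\times(0,\infty)$ and $\Psi:[0,\infty)\to[0,\infty)$, extended by $\Psi(\infty)=\infty$, say that $\mu\in Cap^{\Psi}(\Lambda^\infty_d)$ (respectively $\mu\in Cap^{\Psi}(h^\alpha_p)$) if $\mu(TO)\prec\Psi(\Lambda^\infty_d(O))$ (respectively $\mu(TO)\prec\Psi(cap(O;h^\alpha_p))$) uniformly for all open sets $O\subset\mathbb R^n$, and that $\mu\in C^\Phi$ if $\mu(TB_r)\prec\Phi(r)$ uniformly for all balls $B_r\subset\mathbb R^n$ of radius $r>0$.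 Then, with $\Phi_\alpha(s)=\Phi(s^{1/(n-\alpha p)})$, $$Cap^{\Phi_\alpha}(\Lambda^\infty_{n-\alpha p})=Cap^{\Phi_\alpha}(h^\alpha_p)=C^\Phi.$$ -/

import Mathlib

open scoped NNReal ENNReal SchwartzMap
open MeasureTheory

noncomputable section

namespace CapacityMeasures

/-- Euclidean space `ℝⁿ`. -/
abbrev Euc (n : ℕ) : Type := EuclideanSpace ℝ (Fin n)

/-- The open upper half-space `ℝⁿ × (0, ∞)`, with its Borel σ-algebra. -/
abbrev UpperHalf (n : ℕ) : Type := {z : Euc n × ℝ // 0 < z.2}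

/-- The tent `TO = {(x, t) : x ∈ O, 0 < t < dist(x, ∂O)}`. The distance takes values in
`[0, ∞]`; it is `∞` if `∂O` is empty, so that the tent over `ℝⁿ` is the whole half-space. -/
def tent {n : ℕ} (O : Set (Euc n)) : Set (UpperHalf n) :=
  {z | z.1.1 ∈ O ∧ ENNReal.ofReal z.1.2 < Metric.infEDist z.1.1 (frontier O)}

/-- `X ≺ Y`: there is a finite constant `c` with `X ≤ c Y`. -/
def Dominated (X Y : ℝ≥0 → ℝ≥0) : Prop := ∃ c : ℝ≥0, ∀ s, X s ≤ c * Y s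

/-- `X ≈ Y`: `X ≺ Y` and `Y ≺ X`. -/
def Equivalent (X Y : ℝ≥0 → ℝ≥0) : Prop := Dominated X Y ∧ Dominated Y X

/-- The normalizing constant of the Riesz kernel,
`c(α, n) = Γ((n - α) / 2) / (π ^ (n / 2) 2 ^ α Γ(α / 2))`, for which the Riesz potential of order
`α` is the Fourier multiplier `|ξ| ^ (-α)`. -/
def rieszConst (n : ℕ) (α : ℝ) : ℝ :=
  Real.Gamma (((n : ℝ) - α) / 2) /
    (Real.pi ^ ((n : ℝ) / 2) * (2 : ℝ) ^ α * Real.Gamma (α / 2))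

/-- The Riesz potential `(R^α g)(x) = c(α, n) ∫ |x - y| ^ (α - n) g(y) dy`. For `g ∈ L^p`,
`1 ≤ p < n / α`, the integral converges absolutely for almost every `x`. -/
def rieszPotential {n : ℕ} (α : ℝ) (g : Euc n → ℝ) (x : Euc n) : ℝ :=
  rieszConst n α * ∫ y, ‖x - y‖ ^ (α - (n : ℝ)) * g y

/-- The norm of `f` in the Riesz potential space `h^α_p`: it is `‖g‖_p` if `f = R^α g` (almost
everywhere) with `g ∈ L^p`, and `∞` if there is no such `g`. (The function `g` is determined by `f`
up to a null set, so the infimum is over a single class.) -/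
def rieszNorm {n : ℕ} (α p : ℝ) (f : Euc n → ℝ) : ℝ≥0∞ :=
  ⨅ (g : Euc n → ℝ) (_ : MemLp g (ENNReal.ofReal p) volume)
    (_ : f =ᵐ[volume] rieszPotential α g), eLpNorm g (ENNReal.ofReal p) volume

/-- The Riesz capacity: the infimum of `‖f‖ ^ p` (norm of `h^α_p`) over Schwartz functions `f ≥ 0`
with `f ≥ 1` on `O`; it is `∞` if there is no such `f`. -/
def rieszCap {n : ℕ} (α p : ℝ) (O : Set (Euc n)) : ℝ≥0∞ :=
  ⨅ (f : 𝓢(Euc n, ℝ)) (_ : ∀ x, 0 ≤ f x) (_ : ∀ x ∈ O, 1 ≤ f x), rieszNorm α p f ^ p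

/-- The `d`-dimensional Hausdorff capacity `Λ^∞_d`, `d > 0`: the infimum of `∑ r_j ^ d` over
countable covers of `O` by balls of radii `r_j`. (A ball of radius `0` is empty and contributes
`0 ^ d = 0`, so finite covers are included.) -/
def hausdorffCap {n : ℕ} (d : ℝ) (O : Set (Euc n)) : ℝ≥0∞ :=
  ⨅ (a : ℕ → Euc n) (r : ℕ → ℝ≥0) (_ : O ⊆ ⋃ j, Metric.ball (a j) (r j)),
    ∑' j, (r j : ℝ≥0∞) ^ d

/-- The extension of `Φ` to `[0, ∞]` by `Φ(∞) = ∞`. -/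
def extendTop (Φ : ℝ≥0 → ℝ≥0) (s : ℝ≥0∞) : ℝ≥0∞ :=
  if s = ∞ then ∞ else (Φ s.toNNReal : ℝ≥0∞)

/-- The class of measures generated by the set function `cap` and the function `Φ`:
`μ(TO) ≺ Φ(cap(O))` uniformly for all open sets `O`. -/
def capClass {n : ℕ} (Φ : ℝ≥0 → ℝ≥0) (cap : Set (Euc n) → ℝ≥0∞) :
    Set (Measure (UpperHalf n)) :=
  {μ | ∃ c : ℝ≥0, ∀ O : Set (Euc n), IsOpen O → μ (tent O) ≤ c * extendTop Φ (cap O)}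

/-- The class `C^Φ` of Carleson-type measures: `μ(TB) ≺ Φ(r)` uniformly for all balls `B` of
radius `r`. -/
def carlesonClass {n : ℕ} (Φ : ℝ≥0 → ℝ≥0) : Set (Measure (UpperHalf n)) :=
  {μ | ∃ c : ℝ≥0, ∀ (x : Euc n) (r : ℝ≥0), 0 < r →
    μ (tent (Metric.ball x (r : ℝ))) ≤ c * (Φ r : ℝ≥0∞)}

/-- The integral condition
`∫_0^s [Φ(u) / u ^ d] ^ (1 / p) du / u ≺ [Φ(s) / s ^ d] ^ (1 / p)` for all `s > 0`. -/
def DiniCondition (Φ : ℝ≥0 → ℝ≥0) (d p : ℝ) : Prop :=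
  ∃ c : ℝ≥0, ∀ s : ℝ≥0, 0 < s →
    ∫⁻ u in Set.Ioo (0 : ℝ) s,
        ENNReal.ofReal (((Φ u.toNNReal : ℝ) / u ^ d) ^ (1 / p) / u) ≤
      c * ENNReal.ofReal (((Φ s : ℝ) / (s : ℝ) ^ d) ^ (1 / p))

end CapacityMeasures

end

noncomputable section

namespace CapacityMeasures

/-! ### Gauge functions -/

/-! On a ball of radius `r` both capacities are at most a constant times `r ^ d`, so testing on
balls puts both capacity classes inside `C^Φ` (`capClass_subset_carlesonClass`). The content is the
two converse inclusions. The Dini condition makes `Φ(s) / s ^ d` almost increasing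
(`DiniCondition.almost_increasing`), so gauges can be summed along a cover (`tsum_gauge_le`) and `Φ`
vanishes at `0` at the rate `s ^ d`.

Hausdorff capacity: a cover of `O` by balls is converted into a cover of `TO` by tents over balls
with comparable `∑ r_j ^ d` (`exists_tent_cover`). A point `(x, t)` either lies over a fixed
enlargement of a ball of the cover, or sees only balls smaller than `t`; these carry at least `t ^
d` because `d ≤ n`, and a Vitali selection prevents double counting.

Riesz capacity: if `R^α g ≥ 1` on `O`, averaging over `B(x, t)` bounds below a potential truncated
at scale `t` (`one_le_truncated_potential`). Integrating against `μ` over `E ⊆ TO` of finite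
measure, slicing the kernel by scale `r` and applying Hölder on each slice gives, with `1 / p + 1 /
q = 1`, `μ(E) ≤ A ‖g‖_p δ ^ (-d / p) μ(E) ^ (1 / q) ((c Φ(δ)) ^ (1 / p) + μ(E) ^ (1 / p))`. The
scales below `δ` are controlled by the Dini condition, those above by the total mass. Taking `δ ^ (d
/ p)` large compared with `‖g‖_p` absorbs the last term (`exists_measure_le_gauge`).

The Riesz capacity of a ball needs a Schwartz test function that is a Riesz potential of an `L^p`
function. The Gaussian is one: its fractional Laplacian is an explicit integral of time derivatives
of the heat kernel (`exists_rieszPotential_eq_gaussian`), and dilation handles every radius. -/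

theorem exists_le_mul_of_le {Φ : ℝ≥0 → ℝ≥0}
    (hmono : ∃ Φ' : ℝ≥0 → ℝ≥0, StrictMono Φ' ∧ Equivalent Φ Φ') :
    ∃ C : ℝ≥0, ∀ s t, s ≤ t → Φ s ≤ C * Φ t := by
  obtain ⟨Φ', hΦ', ⟨a, ha⟩, ⟨b, hb⟩⟩ := hmono
  refine ⟨a * b, fun s t hst => ?_⟩
  calc Φ s ≤ a * Φ' s := ha s
    _ ≤ a * Φ' t := by gcongr; exact hΦ'.monotone hst
    _ ≤ a * (b * Φ t) := by gcongr; exact hb t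
    _ = a * b * Φ t := by ring

/-- The Dini condition forces `Φ(s) / s ^ d` to be almost increasing. -/
theorem DiniCondition.almost_increasing {Φ : ℝ≥0 → ℝ≥0} {d p : ℝ} (hd : 0 < d) (hp : 1 < p)
    {A : ℝ≥0} (hA : ∀ s t, s ≤ t → Φ s ≤ A * Φ t) {B : ℝ≥0} (hB : ∀ s, Φ (2 * s) ≤ B * Φ s)
    (hint : DiniCondition Φ d p) :
    ∃ C : ℝ≥0, ∀ s t, 0 < s → s ≤ t → Φ s * t ^ d ≤ C * (Φ t * s ^ d) := by
  obtain ⟨c, hc⟩ := hint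
  have hp0 : 0 < p := by linarith
  refine ⟨(2 * c) ^ p * B * A, fun s t hs hst => ?_⟩
  have ht : 0 < t := hs.trans_le hst
  have hs' : (0 : ℝ) < s := hs
  have ht' : (0 : ℝ) < t := ht
  have hst' : (s : ℝ) ≤ t := hst
  -- `A` is a divisor below; if it is `0`, then `Φ` vanishes identically.
  by_cases hA0 : A = 0
  · have := hA s t hst
    simp only [hA0, zero_mul, nonpos_iff_eq_zero] at this
    simp [this]
  have hA' : (0 : ℝ) < A := by
    have : 0 < A := pos_iff_ne_zero.2 hA0
    exact_mod_cast this
  set K : ℝ := ((Φ s : ℝ) / A / (2 * s) ^ d) ^ (1 / p) with hK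
  have hK0 : 0 ≤ K := by positivity
  -- On `(s, 2s)` the integrand is at least `K / (2s)`. The Dini condition is used at `2t` rather
  -- than `t` so that this interval fits inside for every `s ≤ t`.
  have h1 : ENNReal.ofReal (K / (2 * s)) * ENNReal.ofReal s ≤
      ∫⁻ u in Set.Ioo (0 : ℝ) ((2 * t : ℝ≥0) : ℝ),
        ENNReal.ofReal (((Φ u.toNNReal : ℝ) / u ^ d) ^ (1 / p) / u) := by
    have hsub : Set.Ioo (s : ℝ) (2 * s) ⊆ Set.Ioo (0 : ℝ) ((2 * t : ℝ≥0) : ℝ) := by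
      intro u hu
      refine ⟨hs'.trans hu.1, hu.2.trans_le ?_⟩
      push_cast
      linarith
    refine le_trans ?_ (lintegral_mono_set hsub)
    have hvol : ENNReal.ofReal (s : ℝ) = volume (Set.Ioo (s : ℝ) (2 * s)) := by
      rw [Real.volume_Ioo]
      congr 1
      ring
    rw [hvol, ← setLIntegral_const]
    refine setLIntegral_mono' measurableSet_Ioo fun u hu => ?_
    have hu0 : 0 < u := hs'.trans hu.1
    refine ENNReal.ofReal_le_ofReal ?_
    have hΦ : (Φ s : ℝ) / A ≤ Φ u.toNNReal := by
      rw [div_le_iff₀ hA', mul_comm]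
      have := hA s u.toNNReal (by
        rw [← NNReal.coe_le_coe, Real.coe_toNNReal _ hu0.le]; exact hu.1.le)
      exact_mod_cast this
    have hud : u ^ d ≤ (2 * s : ℝ) ^ d := Real.rpow_le_rpow hu0.le hu.2.le hd.le
    have hud0 : 0 < u ^ d := Real.rpow_pos_of_pos hu0 d
    rw [hK]
    gcongr
    exact hu.2.le
  have h2 := h1.trans (hc (2 * t) (by positivity))
  rw [← ENNReal.ofReal_mul (by positivity), ← ENNReal.ofReal_coe_nnreal,
    ← ENNReal.ofReal_mul (by positivity), ENNReal.ofReal_le_ofReal_iff (by positivity)] at h2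
  have h3 : K ≤ 2 * c * (((Φ (2 * t) : ℝ) / ((2 * t : ℝ≥0) : ℝ) ^ d) ^ (1 / p)) := by
    have : K / (2 * s) * s = K / 2 := by field_simp
    rw [this] at h2
    linarith
  have h4 := Real.rpow_le_rpow hK0 h3 hp0.le
  have hroot : ∀ y : ℝ, 0 ≤ y → (y ^ (1 / p)) ^ p = y := fun y hy => by
    rw [← Real.rpow_mul hy, one_div_mul_cancel hp0.ne', Real.rpow_one]
  rw [Real.mul_rpow (by positivity) (by positivity), hK, hroot _ (by positivity),
    hroot _ (by positivity)] at h4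
  have h5 : (Φ (2 * t) : ℝ) ≤ B * Φ t := by exact_mod_cast hB t
  push_cast at h4
  rw [Real.mul_rpow (by positivity) hs'.le, Real.mul_rpow (by positivity) ht'.le] at h4
  have hs2 : 0 < (s : ℝ) ^ d := Real.rpow_pos_of_pos hs' d
  have ht2 : 0 < (t : ℝ) ^ d := Real.rpow_pos_of_pos ht' d
  have h22 : 0 < (2 : ℝ) ^ d := Real.rpow_pos_of_pos two_pos d
  rw [← NNReal.coe_le_coe]
  push_cast
  have h6 : (Φ s : ℝ) / A / (2 ^ d * s ^ d) ≤ (2 * c) ^ p * (B * Φ t / (2 ^ d * t ^ d)) :=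
    h4.trans (by gcongr)
  have h7 : (Φ s : ℝ) / A / (2 ^ d * s ^ d) * (A * 2 ^ d * s ^ d * t ^ d) ≤
      (2 * c) ^ p * (B * Φ t / (2 ^ d * t ^ d)) * (A * 2 ^ d * s ^ d * t ^ d) := by gcongr
  calc (Φ s : ℝ) * t ^ d = (Φ s : ℝ) / A / (2 ^ d * s ^ d) * (A * 2 ^ d * s ^ d * t ^ d) := by
        field_simp
    _ ≤ _ := h7
    _ = _ := by field_simp

/-- An infimum need not be attained, so tents are first estimated for every `S` with `cap < S ^ d`.
For positive finite capacity take `S ^ d = 2 cap`; for capacity zero let `S → 0`, where `Φ(S) ≤ B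
Φ(1) S ^ d`. -/
theorem le_extendTop_of_forall {Φ Φα : ℝ≥0 → ℝ≥0} {d : ℝ} (hd : 0 < d)
    (hΦα : ∀ s, Φα s = Φ (s ^ (1 / d)))
    (hdil : ∀ c : ℝ≥0, 0 < c → ∃ C : ℝ≥0, ∀ s, Φ (c * s) ≤ C * Φ s)
    {B : ℝ≥0} (hB : ∀ s t, 0 < s → s ≤ t → Φ s * t ^ d ≤ B * (Φ t * s ^ d)) (C : ℝ≥0) :
    ∃ C' : ℝ≥0, ∀ m cap : ℝ≥0∞, (∀ S : ℝ≥0, 0 < S → cap < (S : ℝ≥0∞) ^ d → m ≤ C * Φ S) →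
      m ≤ C' * extendTop Φα cap := by
  obtain ⟨D, hD⟩ := hdil (2 ^ (1 / d)) (NNReal.rpow_pos two_pos)
  -- The `+ 1` keeps the constant nonzero: for infinite capacity, `0 * ∞ = 0` would spoil the bound.
  refine ⟨C * D + 1, fun m cap h => ?_⟩
  rcases eq_or_ne cap ∞ with rfl | htop
  · simp only [extendTop, if_true]
    rw [ENNReal.mul_top]
    · exact le_top
    · simp
  rcases eq_or_ne cap 0 with rfl | h0
  · have key : ∀ S : ℝ≥0, 0 < S → S ≤ 1 → m ≤ ((C * B * Φ 1 * S ^ d : ℝ≥0) : ℝ≥0∞) := by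
      intro S hS hS1
      refine (h S hS (ENNReal.rpow_pos (by exact_mod_cast hS) (by simp))).trans ?_
      rw [← ENNReal.coe_mul, ENNReal.coe_le_coe]
      have := hB S 1 hS hS1
      rw [NNReal.one_rpow, mul_one] at this
      calc C * Φ S ≤ C * (B * (Φ 1 * S ^ d)) := by gcongr
        _ = _ := by ring
    have : m ≤ 0 := by
      have ht : Filter.Tendsto (fun S : ℝ≥0 => ((C * B * Φ 1 * S ^ d : ℝ≥0) : ℝ≥0∞))
          (nhdsWithin 0 (Set.Ioi 0)) (nhds 0) := by
        have h1 : Filter.Tendsto (fun S : ℝ≥0 => C * B * Φ 1 * S ^ d) (nhds 0) (nhds 0) := by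
          have : Continuous fun S : ℝ≥0 => C * B * Φ 1 * S ^ d :=
            continuous_const.mul (NNReal.continuous_rpow_const hd.le)
          simpa [NNReal.zero_rpow hd.ne'] using this.tendsto 0
        have h2 := (ENNReal.tendsto_coe.2 h1).mono_left
          (nhdsWithin_le_nhds (s := Set.Ioi (0 : ℝ≥0)))
        simpa using h2
      refine ge_of_tendsto ht ?_
      filter_upwards [self_mem_nhdsWithin,
        mem_nhdsWithin_of_mem_nhds (Iic_mem_nhds (zero_lt_one' ℝ≥0))] with S hS hS1
      exact key S hS hS1
    exact this.trans bot_le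
  lift cap to ℝ≥0 using htop
  have hcap : 0 < cap := pos_iff_ne_zero.2 (by simpa using h0)
  have h1 := h ((2 * cap) ^ (1 / d)) (NNReal.rpow_pos (by positivity)) (by
    rw [← ENNReal.coe_rpow_of_nonneg _ hd.le, ← NNReal.rpow_mul, one_div_mul_cancel hd.ne',
      NNReal.rpow_one, ENNReal.coe_lt_coe]
    have : (0 : ℝ) < cap := hcap
    rw [← NNReal.coe_lt_coe]
    push_cast
    linarith)
  refine h1.trans ?_
  simp only [extendTop, ENNReal.coe_ne_top, if_false, ENNReal.toNNReal_coe, hΦα]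
  rw [← ENNReal.coe_mul, ← ENNReal.coe_mul, ENNReal.coe_le_coe, NNReal.mul_rpow]
  calc C * Φ (2 ^ (1 / d) * cap ^ (1 / d)) ≤ C * (D * Φ (cap ^ (1 / d))) := by gcongr; exact hD _
    _ = C * D * Φ (cap ^ (1 / d)) := by ring
    _ ≤ (C * D + 1) * Φ (cap ^ (1 / d)) := by gcongr; simp

/-- Each `ρ i` is at most `S`, hence `Φ(ρ i) ≤ B Φ(S) (ρ i / S) ^ d`, and the right side sums. -/
theorem tsum_gauge_le {Φ : ℝ≥0 → ℝ≥0} {d : ℝ} (hd : 0 < d) (hzero : Φ 0 = 0)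
    {B : ℝ≥0} (hB : ∀ s t, 0 < s → s ≤ t → Φ s * t ^ d ≤ B * (Φ t * s ^ d))
    {ι : Type*} (ρ : ι → ℝ≥0) (S : ℝ≥0) (hS : 0 < S)
    (hsum : ∑' i, (ρ i : ℝ≥0∞) ^ d ≤ (S : ℝ≥0∞) ^ d) :
    ∑' i, (Φ (ρ i) : ℝ≥0∞) ≤ B * Φ S := by
  have hSd : 0 < S ^ d := NNReal.rpow_pos hS
  have hle : ∀ i, ρ i ≤ S := by
    intro i
    have := (ENNReal.le_tsum i).trans hsum
    rw [ENNReal.rpow_le_rpow_iff hd] at this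
    exact_mod_cast this
  have hpt : ∀ i, (Φ (ρ i) : ℝ≥0∞) ≤ ((B * Φ S / S ^ d : ℝ≥0) : ℝ≥0∞) * (ρ i : ℝ≥0∞) ^ d := by
    intro i
    rw [← ENNReal.coe_rpow_of_nonneg _ hd.le, ← ENNReal.coe_mul, ENNReal.coe_le_coe]
    rcases eq_or_ne (ρ i) 0 with h | h
    · rw [h, hzero]; exact bot_le
    · have := hB (ρ i) S (pos_iff_ne_zero.2 h) (hle i)
      rw [div_mul_eq_mul_div, le_div_iff₀ hSd]
      calc _ ≤ _ := this
        _ = _ := by ring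
  calc ∑' i, (Φ (ρ i) : ℝ≥0∞)
      ≤ ∑' i, ((B * Φ S / S ^ d : ℝ≥0) : ℝ≥0∞) * (ρ i : ℝ≥0∞) ^ d := ENNReal.tsum_le_tsum hpt
    _ = ((B * Φ S / S ^ d : ℝ≥0) : ℝ≥0∞) * ∑' i, (ρ i : ℝ≥0∞) ^ d := ENNReal.tsum_mul_left
    _ ≤ ((B * Φ S / S ^ d : ℝ≥0) : ℝ≥0∞) * (S : ℝ≥0∞) ^ d := by gcongr
    _ = B * Φ S := by
      rw [← ENNReal.coe_rpow_of_nonneg _ hd.le, ← ENNReal.coe_mul, ← ENNReal.coe_mul,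
        div_mul_cancel₀ _ hSd.ne']

/-! ### Tents -/

/-- A ball is connected, so one centred in `O` and leaving `O` would contain a frontier point, at
distance less than the height. -/
theorem ball_subset_of_mem_tent {n : ℕ} {O : Set (Euc n)} {z : UpperHalf n} (hz : z ∈ tent O) :
    Metric.ball z.1.1 z.1.2 ⊆ O := by
  intro y hy
  by_contra hyO
  have hpre : IsPreconnected (Metric.ball z.1.1 z.1.2) := (convex_ball _ _).isPreconnected
  have hx : z.1.1 ∈ Metric.ball z.1.1 z.1.2 := Metric.mem_ball_self z.2
  have hfr : (Metric.ball z.1.1 z.1.2 ∩ frontier O).Nonempty := by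
    by_contra hne
    rw [Set.not_nonempty_iff_eq_empty] at hne
    have hcov : Metric.ball z.1.1 z.1.2 ⊆ interior O ∪ interior Oᶜ := by
      intro w hw
      have hwf : w ∉ frontier O := fun h => by
        have : w ∈ Metric.ball z.1.1 z.1.2 ∩ frontier O := ⟨hw, h⟩
        rw [hne] at this
        exact this
      have : w ∈ (frontier O)ᶜ := hwf
      rwa [compl_frontier_eq_union_interior] at this
    obtain ⟨w, -, hw1, hw2⟩ := hpre _ _ isOpen_interior isOpen_interior hcov
      ⟨z.1.1, hx, (hcov hx).resolve_right fun h => interior_subset h hz.1⟩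
      ⟨y, hy, (hcov hy).resolve_left fun h => hyO (interior_subset h)⟩
    exact interior_subset hw2 (interior_subset hw1)
  obtain ⟨w, hw, hwf⟩ := hfr
  have h1 : Metric.infEDist z.1.1 (frontier O) ≤ edist z.1.1 w := Metric.infEDist_le_edist_of_mem hwf
  have h2 : edist z.1.1 w < ENNReal.ofReal z.1.2 := by
    rw [edist_dist]
    exact (ENNReal.ofReal_lt_ofReal_iff z.2).2 (by rw [dist_comm]; exact hw)
  exact lt_irrefl _ ((hz.2.trans_le h1).trans h2)

theorem mem_tent_ball {n : ℕ} {a : Euc n} {ρ : ℝ} {z : UpperHalf n}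
    (h : dist z.1.1 a + z.1.2 < ρ) : z ∈ tent (Metric.ball a ρ) := by
  have hz := z.2
  refine ⟨?_, ?_⟩
  · rw [Metric.mem_ball]
    linarith
  · have h1 : ENNReal.ofReal z.1.2 < ENNReal.ofReal (ρ - dist z.1.1 a) :=
      (ENNReal.ofReal_lt_ofReal_iff (by linarith)).2 (by linarith)
    refine h1.trans_le (Metric.le_infEDist.2 fun y hy => ?_)
    have hy' : dist y a = ρ := Metric.frontier_ball_subset_sphere hy
    rw [edist_dist]
    refine ENNReal.ofReal_le_ofReal ?_
    have := dist_triangle y z.1.1 a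
    rw [dist_comm y z.1.1] at this
    linarith

theorem isOpen_tent {n : ℕ} {O : Set (Euc n)} (hO : IsOpen O) : IsOpen (tent O) := by
  have h1 : IsOpen {z : UpperHalf n | z.1.1 ∈ O} :=
    hO.preimage (continuous_fst.comp continuous_subtype_val)
  have h2 : IsOpen {z : UpperHalf n |
      ENNReal.ofReal z.1.2 < Metric.infEDist z.1.1 (frontier O)} :=
    isOpen_lt (ENNReal.continuous_ofReal.comp (continuous_snd.comp continuous_subtype_val))
      (Metric.continuous_infEDist.comp (continuous_fst.comp continuous_subtype_val))
  exact h1.inter h2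

theorem tent_empty {n : ℕ} : tent (∅ : Set (Euc n)) = ∅ := by
  ext z
  simp [tent]

/-! ### Hausdorff capacity -/

theorem hausdorffCap_ball_le {n : ℕ} {d : ℝ} (hd : 0 < d) (x : Euc n) (r : ℝ≥0) :
    hausdorffCap d (Metric.ball x (r : ℝ)) ≤ (r : ℝ≥0∞) ^ d := by
  refine (iInf₂_le (fun _ => x) (fun j => if j = 0 then r else 0)).trans ?_
  refine (iInf_le _ ?_).trans ?_
  · intro y hy
    exact Set.mem_iUnion.2 ⟨0, by simpa using hy⟩
  · rw [tsum_eq_single 0]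
    · simp
    · intro j hj
      simp [hj, ENNReal.zero_rpow_of_pos hd]

theorem volume_ball {n : ℕ} (hn : 0 < n) (y : Euc n) (s : ℝ≥0) :
    volume (Metric.ball y (s : ℝ)) =
      (s : ℝ≥0∞) ^ (n : ℝ) * volume (Metric.ball (0 : Euc n) 1) := by
  have : Nonempty (Fin n) := ⟨⟨0, hn⟩⟩
  rw [Measure.addHaar_ball volume y s.coe_nonneg, finrank_euclideanSpace_fin,
    ENNReal.ofReal_pow s.coe_nonneg]
  simp

/-- If the balls `ball (a j) (r j)` cover `ball x t` and those that meet it have radius less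
than `t`, then the balls contained in `ball x (3 t)` already have `∑ r_j ^ d ≥ t ^ d`. -/
theorem rpow_le_tsum_of_ball_subset {n : ℕ} {d : ℝ} (hd : 0 < d) (hdn : d ≤ n)
    {a : ℕ → Euc n} {r : ℕ → ℝ≥0} {x : Euc n} {t : ℝ≥0} (ht : 0 < t)
    (hcov : Metric.ball x (t : ℝ) ⊆ ⋃ j, Metric.ball (a j) (r j))
    (hsmall : ∀ j, (Metric.ball (a j) (r j : ℝ) ∩ Metric.ball x (t : ℝ)).Nonempty → r j < t) :
    (t : ℝ≥0∞) ^ d ≤ ∑' j, {j | Metric.ball (a j) (r j : ℝ) ⊆ Metric.ball x (3 * t)}.indicator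
      (fun j => (r j : ℝ≥0∞) ^ d) j := by
  have hvol := volume_ball (n := n) (by
    have : (0 : ℝ) < n := hd.trans_le hdn
    exact_mod_cast this)
  have hV0 : volume (Metric.ball (0 : Euc n) 1) ≠ 0 := (Metric.measure_ball_pos _ _ one_pos).ne'
  have hVt : volume (Metric.ball (0 : Euc n) 1) ≠ ∞ := measure_ball_lt_top.ne
  -- Since `n - d ≥ 0`, a ball of radius `r j < t` has volume at most a multiple of `r j ^ d * t ^
  -- (n - d)`; comparing volumes and cancelling `t ^ (n - d)` gives the claim.
  have hpow : ∀ s : ℝ≥0, (s : ℝ≥0∞) ^ (n : ℝ) = (s : ℝ≥0∞) ^ d * (s : ℝ≥0∞) ^ ((n : ℝ) - d) := by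
    intro s
    rw [← ENNReal.rpow_add_of_nonneg _ _ hd.le (sub_nonneg.2 hdn)]
    congr 1
    ring
  set J := {j | Metric.ball (a j) (r j : ℝ) ⊆ Metric.ball x (3 * t)} with hJ
  have h1 : (t : ℝ≥0∞) ^ (n : ℝ) * volume (Metric.ball (0 : Euc n) 1) ≤
      ((∑' j, J.indicator (fun j => (r j : ℝ≥0∞) ^ d) j) * (t : ℝ≥0∞) ^ ((n : ℝ) - d)) *
        volume (Metric.ball (0 : Euc n) 1) := by
    rw [← hvol x t]
    calc volume (Metric.ball x (t : ℝ))
        ≤ volume (⋃ j, Metric.ball (a j) (r j : ℝ) ∩ Metric.ball x (t : ℝ)) := by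
          rw [← Set.iUnion_inter]
          exact measure_mono fun y hy => ⟨hcov hy, hy⟩
      _ ≤ ∑' j, volume (Metric.ball (a j) (r j : ℝ) ∩ Metric.ball x (t : ℝ)) := measure_iUnion_le _
      _ ≤ ∑' j, J.indicator (fun j => (r j : ℝ≥0∞) ^ d) j * ((t : ℝ≥0∞) ^ ((n : ℝ) - d) *
            volume (Metric.ball (0 : Euc n) 1)) := by
          refine ENNReal.tsum_le_tsum fun j => ?_
          rcases Set.eq_empty_or_nonempty (Metric.ball (a j) (r j : ℝ) ∩ Metric.ball x (t : ℝ))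
            with h | h
          · rw [h, measure_empty]; exact bot_le
          · have hj := hsmall j h
            have hjJ : j ∈ J := by
              obtain ⟨w, hw1, hw2⟩ := h
              intro y hy
              rw [Metric.mem_ball] at *
              have h1 := dist_triangle y (a j) x
              have h2 := dist_triangle (a j) w x
              rw [dist_comm (a j) w] at h2
              have h3 : (r j : ℝ) < t := hj
              linarith
            rw [Set.indicator_of_mem hjJ]
            refine (measure_mono Set.inter_subset_left).trans ?_
            rw [hvol, hpow, mul_assoc]
            gcongr
      _ = _ := by rw [ENNReal.tsum_mul_right, mul_assoc]
  rw [ENNReal.mul_le_mul_iff_left hV0 hVt, hpow] at h1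
  have ht0 : (t : ℝ≥0∞) ^ ((n : ℝ) - d) ≠ 0 :=
    (ENNReal.rpow_pos (by exact_mod_cast ht) ENNReal.coe_ne_top).ne'
  have htt : (t : ℝ≥0∞) ^ ((n : ℝ) - d) ≠ ∞ :=
    ENNReal.rpow_ne_top_of_nonneg (sub_nonneg.2 hdn) ENNReal.coe_ne_top
  rwa [ENNReal.mul_le_mul_iff_left ht0 htt] at h1

/-- At most one of the disjoint sets can contain the nonempty set `F`, so at most one term is
nonzero. -/
theorem tsum_indicator_le_of_pairwiseDisjoint {ι X : Type*} {u : Set ι} {B : ι → Set X}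
    (hu : u.PairwiseDisjoint B) {F : Set X} (hF : F.Nonempty) (c : ℝ≥0∞) :
    ∑' i : u, {i : u | F ⊆ B i}.indicator (fun _ => c) i ≤ c := by
  by_cases h : ∃ i : u, F ⊆ B i
  · obtain ⟨i, hi⟩ := h
    rw [tsum_eq_single i]
    · exact Set.indicator_le_self _ _ _
    · intro j hj
      refine Set.indicator_of_notMem (fun hj' => ?_) _
      obtain ⟨w, hw⟩ := hF
      exact Set.disjoint_left.1 (hu j.2 i.2 fun h => hj (Subtype.ext h)) (hj' hw) (hi hw)
  · push Not at h
    have : ∀ i : u, {i : u | F ⊆ B i}.indicator (fun _ => c) i = 0 :=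
      fun i => Set.indicator_of_notMem (h i) _
    simp [this]

/-- A tent over a set covered by balls is covered by tents over balls, with control on the sum of
the radii to the power `d`. -/
theorem exists_tent_cover {n : ℕ} {d : ℝ} (hd : 0 < d) (hdn : d ≤ n) {O : Set (Euc n)}
    {a : ℕ → Euc n} {r : ℕ → ℝ≥0} (hcov : O ⊆ ⋃ j, Metric.ball (a j) (r j))
    (hfin : ∑' j, (r j : ℝ≥0∞) ^ d ≠ ∞) :
    ∃ (ι : Type) (_ : Countable ι) (b : ι → Euc n) (ρ : ι → ℝ≥0),
      tent O ⊆ ⋃ i, tent (Metric.ball (b i) (ρ i)) ∧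
      ∑' i, (ρ i : ℝ≥0∞) ^ d ≤ (4 ^ d + 11 ^ d) * ∑' j, (r j : ℝ≥0∞) ^ d := by
  set S := ∑' j, (r j : ℝ≥0∞) ^ d with hS
  -- `A` holds the points that see only balls of the cover smaller than their height. Off `A`, some
  -- ball with `r j ≥ t` meets `ball x t`, and then `dist x (a j) + t < r j + 2 t < 4 r j`.
  set A : Set (UpperHalf n) := {z | z ∈ tent O ∧ ∀ j,
    (Metric.ball (a j) (r j : ℝ) ∩ Metric.ball z.1.1 z.1.2).Nonempty → (r j : ℝ) < z.1.2} with hA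
  let h : UpperHalf n → ℝ≥0 := fun z => z.1.2.toNNReal
  have hh : ∀ z, (h z : ℝ) = z.1.2 := fun z => Real.coe_toNNReal _ z.2.le
  have hlow : ∀ z ∈ A, (h z : ℝ≥0∞) ^ d ≤ ∑' j,
      {j | Metric.ball (a j) (r j : ℝ) ⊆ Metric.ball z.1.1 (3 * z.1.2)}.indicator
        (fun j => (r j : ℝ≥0∞) ^ d) j := by
    intro z hz
    have := rpow_le_tsum_of_ball_subset (x := z.1.1) (t := h z) hd hdn
      (by rw [← NNReal.coe_pos, hh]; exact z.2)
      (by rw [hh]; exact (ball_subset_of_mem_tent hz.1).trans hcov)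
      (by
        intro j hj
        rw [hh] at hj
        rw [← NNReal.coe_lt_coe, hh]
        exact hz.2 j hj)
    rwa [hh] at this
  have hbdd : ∀ z ∈ A, 3 * z.1.2 ≤ 3 * (S ^ (1 / d)).toReal := by
    intro z hz
    have h1 : (h z : ℝ≥0∞) ^ d ≤ S :=
      (hlow z hz).trans (ENNReal.tsum_le_tsum fun j => Set.indicator_le_self _ _ _)
    have h2 := ENNReal.rpow_le_rpow h1 (one_div_pos.2 hd).le
    rw [← ENNReal.rpow_mul, mul_one_div_cancel hd.ne', ENNReal.rpow_one] at h2
    have h3 := ENNReal.toReal_mono (ENNReal.rpow_ne_top_of_nonneg (one_div_pos.2 hd).le hfin) h2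
    rw [ENNReal.coe_toReal, hh] at h3
    linarith
  -- With enlargement factor `2`, each `z ∈ A` of height `t` has a selected `b` of height `t'` with
  -- `t ≤ 2 t'` whose tripled ball meets that of `z`. Thus `dist + t < 4 t + 3 t' ≤ 11 t'`, which
  -- explains the radius `11 * h z`.
  obtain ⟨u, huA, hdisj, hu⟩ := Vitali.exists_disjoint_subfamily_covering_enlargement
    (fun z : UpperHalf n => Metric.ball z.1.1 (3 * z.1.2)) A (fun z => 3 * z.1.2) 2 (by norm_num)
    (fun z _ => by have := z.2; positivity) _ hbdd
    (fun z _ => Metric.nonempty_ball.2 (by have := z.2; linarith))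
  have hcount : u.Countable := hdisj.countable_of_isOpen (fun _ _ => Metric.isOpen_ball)
    (fun z _ => Metric.nonempty_ball.2 (by have := z.2; linarith))
  have : Countable u := hcount.to_subtype
  refine ⟨ℕ ⊕ u, inferInstance, Sum.elim a fun z => z.1.1.1,
    Sum.elim (fun j => 4 * r j) fun z => 11 * h z, ?_, ?_⟩
  · intro z hz
    by_cases hzA : z ∈ A
    · obtain ⟨b, hbu, ⟨w, hw1, hw2⟩, hle⟩ := hu z hzA
      refine Set.mem_iUnion.2 ⟨Sum.inr ⟨b, hbu⟩, ?_⟩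
      simp only [Sum.elim_inr]
      apply mem_tent_ball
      push_cast
      rw [hh]
      rw [Metric.mem_ball] at hw1 hw2
      have := dist_triangle z.1.1 w b.1.1
      rw [dist_comm z.1.1 w] at this
      linarith
    · have : ¬ ∀ j, (Metric.ball (a j) (r j : ℝ) ∩ Metric.ball z.1.1 z.1.2).Nonempty →
          (r j : ℝ) < z.1.2 := fun h => hzA ⟨hz, h⟩
      push Not at this
      obtain ⟨j, ⟨w, hw1, hw2⟩, hj⟩ := this
      refine Set.mem_iUnion.2 ⟨Sum.inl j, ?_⟩
      simp only [Sum.elim_inl]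
      apply mem_tent_ball
      push_cast
      rw [Metric.mem_ball] at hw1 hw2
      have := dist_triangle z.1.1 w (a j)
      rw [dist_comm z.1.1 w] at this
      have hz2 := z.2
      linarith
  · rw [ENNReal.summable.tsum_sum ENNReal.summable, add_mul]
    simp only [Sum.elim_inl, Sum.elim_inr, ENNReal.coe_mul]
    simp only [ENNReal.mul_rpow_of_nonneg _ _ hd.le, ENNReal.tsum_mul_left]
    push_cast
    refine add_le_add le_rfl (mul_le_mul_right ?_ _)
    -- Each selected `t ^ d` is charged to the balls of the cover inside its tripled ball; these are
    -- disjoint, so no ball is charged twice.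
    calc ∑' z : u, (h z : ℝ≥0∞) ^ d
        ≤ ∑' z : u, ∑' j, {j | Metric.ball (a j) (r j : ℝ) ⊆
            Metric.ball z.1.1.1 (3 * z.1.1.2)}.indicator (fun j => (r j : ℝ≥0∞) ^ d) j :=
          ENNReal.tsum_le_tsum fun z => hlow z (huA z.2)
      _ = ∑' j, ∑' z : u, {j | Metric.ball (a j) (r j : ℝ) ⊆
            Metric.ball z.1.1.1 (3 * z.1.1.2)}.indicator (fun j => (r j : ℝ≥0∞) ^ d) j :=
          ENNReal.tsum_comm
      _ ≤ S := by
          refine ENNReal.tsum_le_tsum fun j => ?_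
          -- A ball of radius `0` is empty and lies in every selected ball, but its term is `0 ^ d =
          -- 0`.
          rcases eq_or_ne (r j) 0 with h0 | h0
          · simp [Set.indicator, h0, ENNReal.zero_rpow_of_pos hd]
          · exact tsum_indicator_le_of_pairwiseDisjoint hdisj
              (F := Metric.ball (a j) (r j : ℝ))
              (Metric.nonempty_ball.2 (by
                have : 0 < r j := pos_iff_ne_zero.2 h0
                exact_mod_cast this)) _

theorem measure_tent_le_of_hausdorffCap_lt {n : ℕ} {d : ℝ} (hd : 0 < d) (hdn : d ≤ n)
    {Φ : ℝ≥0 → ℝ≥0} (hzero : Φ 0 = 0)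
    (hdil : ∀ c : ℝ≥0, 0 < c → ∃ C : ℝ≥0, ∀ s, Φ (c * s) ≤ C * Φ s)
    {B : ℝ≥0} (hB : ∀ s t, 0 < s → s ≤ t → Φ s * t ^ d ≤ B * (Φ t * s ^ d))
    {μ : Measure (UpperHalf n)} (hμ : μ ∈ carlesonClass Φ) :
    ∃ C : ℝ≥0, ∀ (O : Set (Euc n)) (S : ℝ≥0), 0 < S → hausdorffCap d O < (S : ℝ≥0∞) ^ d →
      μ (tent O) ≤ C * Φ S := by
  obtain ⟨c, hc⟩ := hμ
  -- `K ^ d` is the constant of `exists_tent_cover`, so `(K * S) ^ d` dominates the new sum;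
  -- doubling of `Φ` removes `K` at the end.
  set K : ℝ≥0 := (4 ^ d + 11 ^ d) ^ (1 / d) with hK
  have hK0 : 0 < K := NNReal.rpow_pos (by positivity)
  obtain ⟨D, hD⟩ := hdil K hK0
  refine ⟨c * (B * D), fun O S hS hcap => ?_⟩
  simp only [hausdorffCap, iInf_lt_iff] at hcap
  obtain ⟨a, r, hcov, hsum⟩ := hcap
  obtain ⟨ι, hι, b, ρ, hsub, hρ⟩ := exists_tent_cover hd hdn hcov hsum.ne_top
  have hKd : ((K * S : ℝ≥0) : ℝ≥0∞) ^ d = (4 ^ d + 11 ^ d) * (S : ℝ≥0∞) ^ d := by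
    rw [ENNReal.coe_mul, ENNReal.mul_rpow_of_nonneg _ _ hd.le]
    congr 1
    rw [← ENNReal.coe_rpow_of_nonneg _ hd.le, hK, ← NNReal.rpow_mul, one_div_mul_cancel hd.ne',
      NNReal.rpow_one, ENNReal.coe_add, ENNReal.coe_rpow_of_nonneg _ hd.le,
      ENNReal.coe_rpow_of_nonneg _ hd.le]
    simp
  calc μ (tent O) ≤ ∑' i, μ (tent (Metric.ball (b i) (ρ i : ℝ))) :=
        (measure_mono hsub).trans (measure_iUnion_le _)
    _ ≤ ∑' i, (c : ℝ≥0∞) * Φ (ρ i) := by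
        refine ENNReal.tsum_le_tsum fun i => ?_
        rcases eq_or_ne (ρ i) 0 with h | h
        · simp [h, tent_empty]
        · exact hc _ _ (pos_iff_ne_zero.2 h)
    _ = c * ∑' i, (Φ (ρ i) : ℝ≥0∞) := ENNReal.tsum_mul_left
    _ ≤ c * (B * Φ (K * S)) := by
        gcongr
        refine tsum_gauge_le hd hzero hB ρ (K * S) (by positivity) ?_
        rw [hKd]
        exact hρ.trans (by gcongr)
    _ ≤ c * (B * (D * Φ S)) := by
        gcongr
        exact_mod_cast hD S
    _ = _ := by push_cast; ring

/-! ### The averaged Riesz kernel -/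

theorem lintegral_Ioi_ofReal_rpow {b c : ℝ} (hb : b < -1) (hc : 0 < c) :
    ∫⁻ r in Set.Ioi c, ENNReal.ofReal (r ^ b) = ENNReal.ofReal (-c ^ (b + 1) / (b + 1)) := by
  rw [← integral_Ioi_rpow_of_lt hb hc, ofReal_integral_eq_lintegral_ofReal
    (integrableOn_Ioi_rpow_of_lt hb hc)]
  filter_upwards [self_mem_ae_restrict measurableSet_Ioi] with r hr
  exact Real.rpow_nonneg (hc.trans hr).le _

theorem integrableOn_norm_rpow_ball {n : ℕ} (hn : 0 < n) {α : ℝ} (hα : 0 < α) {R : ℝ} (hR : 0 < R) :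
    IntegrableOn (fun w : Euc n => ‖w‖ ^ (α - (n : ℝ))) (Metric.ball 0 R) := by
  have : Nonempty (Fin n) := ⟨⟨0, hn⟩⟩
  rw [integrableOn_fun_norm_addHaar volume (f := fun y : ℝ => y ^ (α - (n : ℝ)))]
  refine ((intervalIntegral.integrableOn_Ioo_rpow_iff (s := α - 1) hR).2
    (by linarith)).congr_fun (fun y hy => ?_) measurableSet_Ioo
  have hy0 : 0 < y := hy.1
  simp only [finrank_euclideanSpace_fin, smul_eq_mul]
  rw [← Real.rpow_natCast, ← Real.rpow_add hy0]
  congr 1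
  push_cast [Nat.cast_sub hn]
  ring

open Pointwise in
theorem lintegral_ball_rpow_le {n : ℕ} (hn : 0 < n) {α : ℝ} (hα : 0 < α) :
    ∃ C : ℝ≥0, ∀ (y : Euc n) (R : ℝ), 0 < R →
      ∫⁻ w in Metric.ball y R, ENNReal.ofReal (‖w - y‖ ^ (α - (n : ℝ))) ≤
        C * ENNReal.ofReal (R ^ α) := by
  set I : ℝ := ∫ w in Metric.ball (0 : Euc n) 1, ‖w‖ ^ (α - (n : ℝ)) with hI
  have hI0 : 0 ≤ I := integral_nonneg fun w => Real.rpow_nonneg (norm_nonneg _) _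
  refine ⟨I.toNNReal, fun y R hR => ?_⟩
  have h1 : ∫⁻ w in Metric.ball y R, ENNReal.ofReal (‖w - y‖ ^ (α - (n : ℝ))) =
      ∫⁻ w in Metric.ball (0 : Euc n) R, ENNReal.ofReal (‖w‖ ^ (α - (n : ℝ))) := by
    have hmp : MeasurePreserving (fun w : Euc n => w - y) volume volume :=
      measurePreserving_sub_right volume y
    have := hmp.setLIntegral_comp_preimage_emb (MeasurableEquiv.subRight y).measurableEmbedding
      (fun w => ENNReal.ofReal (‖w‖ ^ (α - (n : ℝ)))) (Metric.ball 0 R)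
    rw [← this]
    congr 2
    ext w
    simp [dist_eq_norm]
  have hballR : Metric.ball (0 : Euc n) R = R • Metric.ball (0 : Euc n) 1 := by
    rw [smul_unitBall hR.ne', Real.norm_of_nonneg hR.le]
  have h2 : ∀ w : Euc n, ‖R • w‖ ^ (α - (n : ℝ)) = R ^ (α - (n : ℝ)) * ‖w‖ ^ (α - (n : ℝ)) := by
    intro w
    rw [norm_smul, Real.norm_of_nonneg hR.le, Real.mul_rpow hR.le (norm_nonneg _)]
  have hintR := integrableOn_norm_rpow_ball hn hα hR
  have h3 : ∫ w in Metric.ball (0 : Euc n) R, ‖w‖ ^ (α - (n : ℝ)) = R ^ α * I := by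
    have := Measure.setIntegral_comp_smul_of_pos volume
      (fun w : Euc n => ‖w‖ ^ (α - (n : ℝ))) (Metric.ball (0 : Euc n) 1) hR
    rw [← hballR] at this
    simp only [h2, finrank_euclideanSpace_fin, smul_eq_mul, integral_const_mul] at this
    rw [← hI] at this
    have hRn : (R ^ n : ℝ) ≠ 0 := by positivity
    have h4 : ∫ w in Metric.ball (0 : Euc n) R, ‖w‖ ^ (α - (n : ℝ)) =
        R ^ n * (R ^ (α - (n : ℝ)) * I) := by
      rw [this]
      field_simp
    rw [h4, ← mul_assoc, ← Real.rpow_natCast, ← Real.rpow_add hR]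
    congr 2
    ring
  rw [h1, ← ofReal_integral_eq_lintegral_ofReal hintR
    (ae_of_all _ fun w => Real.rpow_nonneg (norm_nonneg _) _), h3,
    ENNReal.ofReal_mul (by positivity), mul_comm]
  rfl

/-- The average of `‖· - y‖ ^ (α - n)` over `ball x t` is controlled by the truncated kernel. -/
theorem lintegral_ball_kernel_le {n : ℕ} (hn : 0 < n) {α : ℝ} (hα : 0 < α) (hαn : α < n) :
    ∃ C : ℝ≥0, ∀ (x y : Euc n) (t : ℝ), 0 < t →
      ∫⁻ w in Metric.ball x t, ENNReal.ofReal (‖w - y‖ ^ (α - (n : ℝ))) ≤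
        C * volume (Metric.ball x t) *
          ∫⁻ r in Set.Ioi (max t (dist x y / 2)), ENNReal.ofReal (r ^ (α - (n : ℝ) - 1)) := by
  obtain ⟨C₁, hC₁⟩ := lintegral_ball_rpow_le hn hα
  set V := volume (Metric.ball (0 : Euc n) 1) with hV
  have hV0 : V ≠ 0 := (Metric.measure_ball_pos _ _ one_pos).ne'
  have hVt : V ≠ ∞ := measure_ball_lt_top.ne
  have hna : 0 < (n : ℝ) - α := by linarith
  set c : ℝ≥0 := ((n : ℝ) - α).toNNReal with hc
  set v : ℝ≥0 := V.toNNReal with hv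
  have hvV : (v : ℝ≥0∞) = V := ENNReal.coe_toNNReal hVt
  -- The kernel becomes an integral over scales `r > m`, the form in which Tonelli is applied later.
  have hker : ∀ m : ℝ, 0 < m → ENNReal.ofReal (m ^ (α - (n : ℝ))) =
      c * ∫⁻ r in Set.Ioi m, ENNReal.ofReal (r ^ (α - (n : ℝ) - 1)) := by
    intro m hm
    rw [lintegral_Ioi_ofReal_rpow (by linarith) hm, hc]
    change _ = ENNReal.ofReal _ * _
    rw [← ENNReal.ofReal_mul hna.le]
    congr 1
    have : α - (n : ℝ) ≠ 0 := by linarith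
    rw [sub_add_cancel]
    field_simp
    ring
  refine ⟨max c ((3 ^ α : ℝ).toNNReal * C₁ * v⁻¹ * c), fun x y t ht => ?_⟩
  have hvol : volume (Metric.ball x t) = ENNReal.ofReal (t ^ (n : ℝ)) * v := by
    have := volume_ball hn x t.toNNReal
    rw [Real.coe_toNNReal _ ht.le] at this
    rw [hvV, ← ENNReal.ofReal_rpow_of_pos ht]
    exact this
  -- If `y` is far, all of `ball x t` stays at distance at least `dist x y / 2` from `y`; otherwise
  -- it lies in `ball y (3 * t)`, where the kernel has integral of order `t ^ α`, that is, `t ^ n *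
  -- t ^ (α - n)`.
  rcases le_or_gt (2 * t) (dist x y) with h | h
  · have hmax : max t (dist x y / 2) = dist x y / 2 := max_eq_right (by linarith)
    rw [hmax]
    have hm : 0 < dist x y / 2 := by linarith
    calc ∫⁻ w in Metric.ball x t, ENNReal.ofReal (‖w - y‖ ^ (α - (n : ℝ)))
        ≤ ∫⁻ w in Metric.ball x t, ENNReal.ofReal ((dist x y / 2) ^ (α - (n : ℝ))) := by
          refine setLIntegral_mono' measurableSet_ball fun w hw => ENNReal.ofReal_le_ofReal ?_
          refine Real.rpow_le_rpow_of_nonpos hm ?_ (by linarith)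
          rw [← dist_eq_norm]
          have := dist_triangle x w y
          rw [Metric.mem_ball, dist_comm] at hw
          linarith
      _ = c * volume (Metric.ball x t) * ∫⁻ r in Set.Ioi (dist x y / 2),
            ENNReal.ofReal (r ^ (α - (n : ℝ) - 1)) := by
          rw [setLIntegral_const, hker _ hm]
          ring
      _ ≤ _ := by
          gcongr
          exact_mod_cast le_max_left _ _
  · have hmax : max t (dist x y / 2) = t := max_eq_left (by linarith)
    rw [hmax]
    calc ∫⁻ w in Metric.ball x t, ENNReal.ofReal (‖w - y‖ ^ (α - (n : ℝ)))
        ≤ ∫⁻ w in Metric.ball y (3 * t), ENNReal.ofReal (‖w - y‖ ^ (α - (n : ℝ))) := by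
          refine lintegral_mono_set fun w hw => ?_
          rw [Metric.mem_ball] at hw ⊢
          have := dist_triangle w x y
          linarith
      _ ≤ C₁ * ENNReal.ofReal ((3 * t) ^ α) := hC₁ y _ (by positivity)
      _ = ((3 ^ α : ℝ).toNNReal * C₁ * v⁻¹ * c : ℝ≥0) * volume (Metric.ball x t) *
            ∫⁻ r in Set.Ioi t, ENNReal.ofReal (r ^ (α - (n : ℝ) - 1)) := by
          have hv0 : v ≠ 0 := by
            intro h0
            rw [h0] at hvV
            exact hV0 hvV.symm
          have e1 : (v : ℝ≥0∞)⁻¹ * v = 1 :=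
            ENNReal.inv_mul_cancel (by exact_mod_cast hv0) ENNReal.coe_ne_top
          rw [hvol, Real.mul_rpow (by norm_num) ht.le, ENNReal.ofReal_mul (by positivity)]
          push_cast [ENNReal.coe_inv hv0]
          have e2 : ENNReal.ofReal (t ^ α) = ENNReal.ofReal (t ^ (n : ℝ)) *
              (c * ∫⁻ r in Set.Ioi t, ENNReal.ofReal (r ^ (α - (n : ℝ) - 1))) := by
            rw [← hker t ht, ← ENNReal.ofReal_mul (by positivity), ← Real.rpow_add ht]
            congr 2
            ring
          rw [e2]
          change (C₁ : ℝ≥0∞) * (ENNReal.ofReal (3 ^ α) * _) = ENNReal.ofReal (3 ^ α) * _ * _ * _ * _ * _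
          calc _ = ENNReal.ofReal (3 ^ α) * C₁ * ((v : ℝ≥0∞)⁻¹ * v) * c *
                ENNReal.ofReal (t ^ (n : ℝ)) *
                ∫⁻ r in Set.Ioi t, ENNReal.ofReal (r ^ (α - (n : ℝ) - 1)) := by rw [e1]; ring
            _ = _ := by ring
      _ ≤ _ := by
          gcongr
          exact_mod_cast le_max_right _ _

/-- If `R^α |g| ≥ 1` almost everywhere on `O`, then the truncated potential of `|g|` is bounded
below on the tent over `O`. -/
theorem one_le_truncated_potential {n : ℕ} (hn : 0 < n) {α : ℝ} (hα : 0 < α) (hαn : α < n) :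
    ∃ C : ℝ≥0, ∀ (O : Set (Euc n)) (G : Euc n → ℝ≥0∞), Measurable G →
      (∀ᵐ x, x ∈ O → 1 ≤ ENNReal.ofReal |rieszConst n α| *
        ∫⁻ y, ENNReal.ofReal (‖x - y‖ ^ (α - (n : ℝ))) * G y) →
      ∀ z ∈ tent O, 1 ≤ C * ∫⁻ y, G y *
        ∫⁻ r in Set.Ioi (max z.1.2 (dist z.1.1 y / 2)), ENNReal.ofReal (r ^ (α - (n : ℝ) - 1)) := by
  obtain ⟨C, hC⟩ := lintegral_ball_kernel_le hn hα hαn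
  refine ⟨|rieszConst n α|.toNNReal * C, fun O G hG h z hz => ?_⟩
  have hz2 := z.2
  set B := Metric.ball z.1.1 z.1.2 with hB
  have hV0 : volume B ≠ 0 := (Metric.measure_ball_pos _ _ hz2).ne'
  have hVt : volume B ≠ ∞ := measure_ball_lt_top.ne
  have hmeas : Measurable fun q : Euc n × Euc n =>
      ENNReal.ofReal (‖q.1 - q.2‖ ^ (α - (n : ℝ))) * G q.2 :=
    ((measurable_fst.sub measurable_snd).norm.pow_const _).ennreal_ofReal.mul
      (hG.comp measurable_snd)
  -- Averaging over `B ⊆ O` turns the almost everywhere hypothesis on `O` into a bound at every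
  -- point of the tent.
  have key : 1 * volume B ≤ (((|rieszConst n α|.toNNReal * C : ℝ≥0) : ℝ≥0∞) * ∫⁻ y, G y *
        ∫⁻ r in Set.Ioi (max z.1.2 (dist z.1.1 y / 2)), ENNReal.ofReal (r ^ (α - (n : ℝ) - 1))) *
        volume B := by
    calc 1 * volume B = ∫⁻ x in B, 1 := by rw [setLIntegral_const]
      _ ≤ ∫⁻ x in B, ENNReal.ofReal |rieszConst n α| *
            ∫⁻ y, ENNReal.ofReal (‖x - y‖ ^ (α - (n : ℝ))) * G y := by
          refine lintegral_mono_ae ?_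
          filter_upwards [ae_restrict_of_ae h, self_mem_ae_restrict measurableSet_ball] with x hx hxB
          exact hx (ball_subset_of_mem_tent hz hxB)
      _ = ENNReal.ofReal |rieszConst n α| * ∫⁻ x in B,
            ∫⁻ y, ENNReal.ofReal (‖x - y‖ ^ (α - (n : ℝ))) * G y :=
          lintegral_const_mul _ hmeas.lintegral_prod_right'
      _ = ENNReal.ofReal |rieszConst n α| * ∫⁻ y, (∫⁻ x in B,
            ENNReal.ofReal (‖x - y‖ ^ (α - (n : ℝ)))) * G y := by
          rw [lintegral_lintegral_swap hmeas.aemeasurable]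
          congr 2
          ext y
          exact lintegral_mul_const _ ((measurable_id.sub_const y).norm.pow_const _).ennreal_ofReal
      _ ≤ ENNReal.ofReal |rieszConst n α| * ∫⁻ y, (C * volume B) * (G y *
            ∫⁻ r in Set.Ioi (max z.1.2 (dist z.1.1 y / 2)),
              ENNReal.ofReal (r ^ (α - (n : ℝ) - 1))) := by
          refine mul_le_mul_right (lintegral_mono fun y => ?_) _
          calc _ ≤ _ := mul_le_mul_left (hC z.1.1 y z.1.2 hz2) _
            _ = _ := by ring
      _ = _ := by
          rw [lintegral_const_mul' _ _ (ENNReal.mul_ne_top ENNReal.coe_ne_top hVt)]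
          push_cast
          change _ = ENNReal.ofReal _ * _ * _ * _
          ring
  rwa [ENNReal.mul_le_mul_iff_left hV0 hVt] at key

/-! ### The trace estimate -/

/-- Hölder, with the `L^q` norm of `m` interpolated between its supremum and its integral: `m ^ q ≤
K ^ (q - 1) * m` and `(q - 1) / q = 1 / p`. -/
theorem lintegral_mul_le_of_le {X : Type*} [MeasurableSpace X] {ν : Measure X} {p q : ℝ}
    (hpq : p.HolderConjugate q) {G m : X → ℝ≥0∞} (hG : Measurable G) (hm : Measurable m)
    {K M : ℝ≥0∞} (hK : ∀ y, m y ≤ K) (hM : ∫⁻ y, m y ∂ν ≤ M) :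
    ∫⁻ y, G y * m y ∂ν ≤ (∫⁻ y, G y ^ p ∂ν) ^ (1 / p) * (K ^ (1 / p) * M ^ (1 / q)) := by
  have hp := hpq.pos
  have hq := hpq.symm.pos
  have hq1 := hpq.symm.lt
  refine (ENNReal.lintegral_mul_le_Lp_mul_Lq ν hpq hG.aemeasurable hm.aemeasurable).trans ?_
  gcongr
  have h1 : ∫⁻ y, m y ^ q ∂ν ≤ K ^ (q - 1) * M := by
    calc ∫⁻ y, m y ^ q ∂ν ≤ ∫⁻ y, K ^ (q - 1) * m y ∂ν := by
          refine lintegral_mono fun y => ?_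
          have : m y ^ q = m y ^ (q - 1) * m y := by
            conv_rhs => rw [← ENNReal.rpow_one (m y), ← ENNReal.rpow_mul, one_mul]
            rw [← ENNReal.rpow_add_of_nonneg _ _ (by linarith) zero_le_one]
            congr 1
            ring
          simp only [this]
          gcongr
          exact hK y
      _ = K ^ (q - 1) * ∫⁻ y, m y ∂ν := lintegral_const_mul _ hm
      _ ≤ K ^ (q - 1) * M := by gcongr
  calc (∫⁻ y, m y ^ q ∂ν) ^ (1 / q) ≤ (K ^ (q - 1) * M) ^ (1 / q) := by gcongr
    _ = K ^ (1 / p) * M ^ (1 / q) := by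
      rw [ENNReal.mul_rpow_of_nonneg _ _ (by positivity), ← ENNReal.rpow_mul]
      congr 2
      have := hpq.inv_add_inv_eq_one
      field_simp
      field_simp at this
      linarith

/-- Dividing by `M ^ (1 / q)` leaves `M ^ (1 / p)` at most half of `F ^ (1 / p) + M ^ (1 / p)`.
Absorption requires `M` finite, hence the later restriction to sets of finite measure. -/
theorem le_of_le_half_mul_add {p q : ℝ} (hpq : p.HolderConjugate q) {M F h : ℝ≥0∞} (hM : M ≠ ∞)
    (hh : h ≤ 2⁻¹) (hle : M ≤ h * M ^ (1 / q) * (F ^ (1 / p) + M ^ (1 / p))) : M ≤ F := by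
  have hp := hpq.pos
  have hq := hpq.symm.pos
  rcases eq_or_ne M 0 with rfl | h0
  · exact bot_le
  have hMq : M ^ (1 / q) ≠ 0 := (ENNReal.rpow_pos (pos_iff_ne_zero.2 h0) hM).ne'
  have hMq' : M ^ (1 / q) ≠ ∞ := ENNReal.rpow_ne_top_of_nonneg (by positivity) hM
  have hMp' : M ^ (1 / p) ≠ ∞ := ENNReal.rpow_ne_top_of_nonneg (by positivity) hM
  have hsplit : M = M ^ (1 / q) * M ^ (1 / p) := by
    rw [← ENNReal.rpow_add_of_nonneg _ _ (by positivity) (by positivity)]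
    have : 1 / q + 1 / p = 1 := by
      have := hpq.inv_add_inv_eq_one
      rw [one_div, one_div]
      linarith
    rw [this, ENNReal.rpow_one]
  have h1 : M ^ (1 / q) * M ^ (1 / p) ≤ M ^ (1 / q) * (2⁻¹ * (F ^ (1 / p) + M ^ (1 / p))) := by
    rw [← hsplit]
    calc M ≤ _ := hle
      _ ≤ 2⁻¹ * M ^ (1 / q) * (F ^ (1 / p) + M ^ (1 / p)) := by gcongr
      _ = _ := by ring
  rw [ENNReal.mul_le_mul_iff_right hMq hMq'] at h1
  have h2 : M ^ (1 / p) ≤ F ^ (1 / p) := by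
    have h3 := mul_le_mul_right h1 2
    rw [← mul_assoc, ENNReal.mul_inv_cancel two_ne_zero ENNReal.ofNat_ne_top, one_mul, two_mul] at h3
    exact (ENNReal.add_le_add_iff_right hMp').1 h3
  rwa [ENNReal.rpow_le_rpow_iff (by positivity)] at h2

/-- Points of the half-space of height less than `r` that project to `ball y (2 r)`. -/
def cylinder {n : ℕ} (y : Euc n) (r : ℝ) : Set (UpperHalf n) :=
  {z | z.1.2 < r ∧ dist z.1.1 y < 2 * r}

theorem measurableSet_cylinder_prod {n : ℕ} :
    MeasurableSet {q : (UpperHalf n × Euc n) × ℝ | q.1.1 ∈ cylinder q.1.2 q.2} := by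
  refine (measurableSet_lt (f := fun q : (UpperHalf n × Euc n) × ℝ => q.1.1.1.2) ?_
    measurable_snd).inter (measurableSet_lt
      (f := fun q : (UpperHalf n × Euc n) × ℝ => dist q.1.1.1.1 q.1.2) ?_
      (measurable_snd.const_mul 2))
  · exact measurable_snd.comp (measurable_subtype_coe.comp (measurable_fst.comp measurable_fst))
  · exact (measurable_fst.comp (measurable_subtype_coe.comp
      (measurable_fst.comp measurable_fst))).dist (measurable_snd.comp measurable_fst)

theorem cylinder_subset_tent {n : ℕ} (y : Euc n) (r : ℝ) :
    cylinder y r ⊆ tent (Metric.ball y (4 * r)) := by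
  intro z hz
  obtain ⟨h1, h2⟩ := hz
  have := z.2
  exact mem_tent_ball (by linarith)

/-- By Tonelli: a given `z` belongs to `cylinder y r` only for `y` in a ball of radius `2 r`. -/
theorem lintegral_measure_cylinder_le {n : ℕ} (hn : 0 < n) (ν : Measure (UpperHalf n))
    [IsFiniteMeasure ν] (r : ℝ) (hr : 0 < r) :
    ∫⁻ y, ν (cylinder y r) ≤ ENNReal.ofReal (r ^ (n : ℝ)) *
      (ENNReal.ofReal (2 ^ (n : ℝ)) * volume (Metric.ball (0 : Euc n) 1)) * ν Set.univ := by
  have hms : MeasurableSet {q : UpperHalf n × Euc n | q.1 ∈ cylinder q.2 r} :=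
    measurableSet_cylinder_prod.preimage (measurable_id.prodMk measurable_const)
  have hmeas : Measurable fun q : UpperHalf n × Euc n => (cylinder q.2 r).indicator (1 : UpperHalf n → ℝ≥0∞) q.1 :=
    measurable_one.indicator hms
  have h1 : ∀ y, ν (cylinder y r) = ∫⁻ z, (cylinder y r).indicator (1 : UpperHalf n → ℝ≥0∞) z ∂ν := fun y =>
    (lintegral_indicator_one (hms.preimage (measurable_id.prodMk measurable_const))).symm
  simp_rw [h1]
  rw [← lintegral_lintegral_swap hmeas.aemeasurable, ← lintegral_const]
  refine lintegral_mono fun z => ?_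
  calc ∫⁻ y, (cylinder y r).indicator (1 : UpperHalf n → ℝ≥0∞) z
      ≤ ∫⁻ y, (Metric.ball z.1.1 (2 * r)).indicator 1 y := by
        refine lintegral_mono fun y => ?_
        by_cases h : z ∈ cylinder y r
        · rw [Set.indicator_of_mem h, Set.indicator_of_mem]
          · simp
          · rw [Metric.mem_ball, dist_comm]; exact h.2
        · rw [Set.indicator_of_notMem h]; exact bot_le
    _ = volume (Metric.ball z.1.1 (2 * r)) := lintegral_indicator_one measurableSet_ball
    _ = _ := by
        have := volume_ball hn z.1.1 (2 * r).toNNReal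
        rw [Real.coe_toNNReal _ (by positivity)] at this
        rw [this, ← mul_assoc, ← ENNReal.ofReal_mul (by positivity),
          ← Real.mul_rpow hr.le zero_le_two, mul_comm r, ← ENNReal.ofReal_rpow_of_pos (by positivity)]
        rfl

/-- The condition `max t (dist x y / 2) < r` says exactly that `(x, t) ∈ cylinder y r`. Integrating
the lower bound over `E` and exchanging integrals gives the claim; finiteness of `μ E` legitimizes
Tonelli for an arbitrary `μ`. -/
theorem measure_le_lintegral_cylinder {n : ℕ} {α : ℝ} {μ : Measure (UpperHalf n)}
    {E : Set (UpperHalf n)} (hE : MeasurableSet E) (hfin : μ E ≠ ∞) {G : Euc n → ℝ≥0∞}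
    (hG : Measurable G) {C : ℝ≥0} (hlow : ∀ z ∈ E, 1 ≤ C * ∫⁻ y, G y *
        ∫⁻ r in Set.Ioi (max z.1.2 (dist z.1.1 y / 2)), ENNReal.ofReal (r ^ (α - (n : ℝ) - 1))) :
    μ E ≤ C * ∫⁻ r in Set.Ioi (0 : ℝ), ENNReal.ofReal (r ^ (α - (n : ℝ) - 1)) *
      ∫⁻ y, G y * (μ.restrict E) (cylinder y r) := by
  have : IsFiniteMeasure (μ.restrict E) := ⟨by simpa using hfin.lt_top⟩
  set w : ℝ → ℝ≥0∞ := fun r => ENNReal.ofReal (r ^ (α - (n : ℝ) - 1)) with hw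
  have hwm : Measurable w := (measurable_id.pow_const _).ennreal_ofReal
  let χ : UpperHalf n → Euc n → ℝ → ℝ≥0∞ := fun z y r =>
    (cylinder y r).indicator (1 : UpperHalf n → ℝ≥0∞) z
  have hχ : Measurable fun q : (UpperHalf n × Euc n) × ℝ => χ q.1.1 q.1.2 q.2 :=
    measurable_one.indicator measurableSet_cylinder_prod
  have hinner : ∀ (z : UpperHalf n) (y : Euc n),
      ∫⁻ r in Set.Ioi (max z.1.2 (dist z.1.1 y / 2)), w r =
        ∫⁻ r in Set.Ioi (0 : ℝ), χ z y r * w r := by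
    intro z y
    rw [← lintegral_indicator measurableSet_Ioi, ← lintegral_indicator measurableSet_Ioi]
    congr 1
    ext r
    have hz := z.2
    by_cases h : max z.1.2 (dist z.1.1 y / 2) < r
    · have h' := max_lt_iff.1 h
      rw [Set.indicator_of_mem (Set.mem_Ioi.2 h), Set.indicator_of_mem (Set.mem_Ioi.2 (hz.trans h'.1))]
      have : z ∈ cylinder y r := ⟨h'.1, by linarith [h'.2]⟩
      simp [χ, this]
    · rw [Set.indicator_of_notMem (by simpa using h)]
      have : z ∉ cylinder y r := fun hc => h (max_lt hc.1 (by linarith [hc.2]))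
      rw [Set.indicator_apply]
      simp [χ, this]
  have hmF : Measurable fun q : (UpperHalf n × Euc n) × ℝ => G q.1.2 * (χ q.1.1 q.1.2 q.2 * w q.2) :=
    (hG.comp (measurable_snd.comp measurable_fst)).mul (hχ.mul (hwm.comp measurable_snd))
  calc μ E = ∫⁻ z in E, 1 ∂μ := by simp
    _ ≤ ∫⁻ z in E, (C * ∫⁻ y, ∫⁻ r in Set.Ioi (0 : ℝ), G y * (χ z y r * w r)) ∂μ := by
        refine setLIntegral_mono' hE fun z hz => (hlow z hz).trans_eq ?_
        congr 2
        ext y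
        rw [hinner, lintegral_const_mul _ ?_]
        exact (hχ.comp (measurable_prodMk_left (x := (z, y)))).mul hwm
    _ = C * ∫⁻ z in E, (∫⁻ y, ∫⁻ r in Set.Ioi (0 : ℝ), G y * (χ z y r * w r)) ∂μ :=
        lintegral_const_mul' _ _ ENNReal.coe_ne_top
    _ = C * ∫⁻ y, ∫⁻ z in E, (∫⁻ r in Set.Ioi (0 : ℝ), G y * (χ z y r * w r)) ∂μ := by
        rw [lintegral_lintegral_swap]
        exact hmF.lintegral_prod_right'.aemeasurable
    _ = C * ∫⁻ y, ∫⁻ r in Set.Ioi (0 : ℝ), ∫⁻ z in E, G y * (χ z y r * w r) ∂μ := by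
        congr 2
        ext y
        rw [lintegral_lintegral_swap]
        exact (hmF.comp ((measurable_fst.prodMk measurable_const).prodMk
          measurable_snd)).aemeasurable
    _ = C * ∫⁻ r in Set.Ioi (0 : ℝ), ∫⁻ y, ∫⁻ z in E, G y * (χ z y r * w r) ∂μ := by
        rw [lintegral_lintegral_swap]
        refine Measurable.aemeasurable ?_
        exact (hmF.comp ((measurable_snd.prodMk (measurable_fst.comp measurable_fst)).prodMk
          (measurable_snd.comp measurable_fst))).lintegral_prod_right'
    _ = _ := by
        congr 2
        ext r
        have h1 : ∀ y, ∫⁻ z in E, G y * (χ z y r * w r) ∂μ =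
            w r * (G y * (μ.restrict E) (cylinder y r)) := by
          intro y
          have hms : MeasurableSet (cylinder y r) :=
            measurableSet_cylinder_prod.preimage
              ((measurable_id.prodMk measurable_const).prodMk measurable_const)
          have hm1 : Measurable fun z => χ z y r := measurable_one.indicator hms
          rw [lintegral_const_mul _ (hm1.mul_const _), lintegral_mul_const _ hm1,
            lintegral_indicator_one hms]
          ring
        simp_rw [h1]
        rw [lintegral_const_mul]
        refine hG.mul (measurable_measure_prodMk_left (ν := μ.restrict E)
          (s := {q : Euc n × UpperHalf n | q.2 ∈ cylinder q.1 r}) ?_)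
        exact measurableSet_cylinder_prod.preimage
          ((measurable_snd.prodMk measurable_fst).prodMk measurable_const)

/-- The trace estimate: a set of finite measure on which the truncated potential of `G` is bounded
below has `μ`-measure at most `Φ(δ)` as soon as `‖G‖_p` is small compared with `δ ^ (d / p)`. -/
theorem exists_measure_le_gauge {n : ℕ} (hn : 0 < n) {α p d : ℝ} (hp : 1 < p)
    (hd : 0 < d) (hdef : d = n - α * p) {Φ : ℝ≥0 → ℝ≥0}
    (hdil : ∀ c : ℝ≥0, 0 < c → ∃ C : ℝ≥0, ∀ s, Φ (c * s) ≤ C * Φ s)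
    (hint : DiniCondition Φ d p) {μ : Measure (UpperHalf n)} (hμ : μ ∈ carlesonClass Φ) (C : ℝ≥0) :
    ∃ A : ℝ≥0, ∃ C' : ℝ≥0, ∀ (E : Set (UpperHalf n)) (G : Euc n → ℝ≥0∞),
      MeasurableSet E → μ E ≠ ∞ → Measurable G →
      ∫⁻ y, G y ^ p ≠ ∞ → (∀ z ∈ E, 1 ≤ C * ∫⁻ y, G y * ∫⁻ r in Set.Ioi (max z.1.2 (dist z.1.1 y / 2)),
        ENNReal.ofReal (r ^ (α - (n : ℝ) - 1))) →
      ∀ δ : ℝ≥0, 0 < δ →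
        A * (∫⁻ y, G y ^ p) ^ (1 / p) * ENNReal.ofReal ((δ : ℝ) ^ (-(d / p))) ≤ 2⁻¹ →
        μ E ≤ C' * Φ δ := by
  obtain ⟨c₀, hc₀⟩ := hμ
  obtain ⟨D, hD⟩ := hdil 4 (by norm_num)
  obtain ⟨cI, hcI⟩ := hint
  have hp0 : 0 < p := by linarith
  have hpq : p.HolderConjugate p.conjExponent := .conjExponent hp
  set q := p.conjExponent with hq
  have hq0 := hpq.symm.pos
  set V := volume (Metric.ball (0 : Euc n) 1) with hV
  have hVt : V ≠ ∞ := measure_ball_lt_top.ne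
  set L : ℝ≥0∞ := (ENNReal.ofReal (2 ^ (n : ℝ)) * V) ^ (1 / q) with hL
  have hLt : L ≠ ∞ :=
    ENNReal.rpow_ne_top_of_nonneg (by positivity) (ENNReal.mul_ne_top ENNReal.ofReal_ne_top hVt)
  set b := d / p with hb
  have hb0 : 0 < b := by positivity
  set A : ℝ≥0 := C * L.toNNReal * (cI + (1 / b).toNNReal) with hA
  refine ⟨A, c₀ * D, fun E G hE hfin hG hGp hlow δ hδ hsmall => ?_⟩
  have hδ' : (0 : ℝ) < δ := hδ
  have : IsFiniteMeasure (μ.restrict E) := ⟨by simpa using hfin.lt_top⟩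
  set N := (∫⁻ y, G y ^ p) ^ (1 / p) with hN
  set M := μ E with hM
  have hNt : N ≠ ∞ := ENNReal.rpow_ne_top_of_nonneg (by positivity) hGp
  have hconst : N * L * M ^ (1 / q) ≠ ∞ := ENNReal.mul_ne_top (ENNReal.mul_ne_top hNt hLt)
    (ENNReal.rpow_ne_top_of_nonneg (by positivity) hfin)
  -- The exponents combine as `α - n + n / q = α - n / p = -d / p`.
  have hexp : ∀ r : ℝ, 0 < r → ENNReal.ofReal (r ^ (α - (n : ℝ) - 1)) *
      ENNReal.ofReal (r ^ (n : ℝ)) ^ (1 / q) = ENNReal.ofReal (r ^ (-b - 1)) := by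
    intro r hr
    rw [ENNReal.ofReal_rpow_of_nonneg (by positivity) (by positivity),
      ← ENNReal.ofReal_mul (by positivity), ← Real.rpow_mul hr.le, ← Real.rpow_add hr]
    congr 2
    have h1 : 1 / q = 1 - 1 / p := by
      have := hpq.inv_add_inv_eq_one
      rw [one_div, one_div]
      linarith
    rw [h1, hb, hdef]
    field_simp
    ring
  -- Hölder on a single scale. The bound `K` is left free: a multiple of `Φ(r)` below `δ`, where it
  -- reproduces the Dini integrand, and the total mass `M` above `δ`, where a convergent power
  -- integral remains.
  have hslice : ∀ r : ℝ, 0 < r → ∀ K : ℝ≥0∞, (∀ y, (μ.restrict E) (cylinder y r) ≤ K) →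
      ENNReal.ofReal (r ^ (α - (n : ℝ) - 1)) * ∫⁻ y, G y * (μ.restrict E) (cylinder y r) ≤
        N * L * M ^ (1 / q) * (K ^ (1 / p) * ENNReal.ofReal (r ^ (-b - 1))) := by
    intro r hr K hK
    have hm : Measurable fun y => (μ.restrict E) (cylinder y r) := by
      refine measurable_measure_prodMk_left (ν := μ.restrict E)
        (s := {q : Euc n × UpperHalf n | q.2 ∈ cylinder q.1 r}) ?_
      exact measurableSet_cylinder_prod.preimage
        ((measurable_snd.prodMk measurable_fst).prodMk measurable_const)
    have h1 := lintegral_mul_le_of_le hpq hG hm hK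
      (lintegral_measure_cylinder_le hn (μ.restrict E) r hr)
    rw [Measure.restrict_apply_univ] at h1
    calc _ ≤ ENNReal.ofReal (r ^ (α - (n : ℝ) - 1)) * _ := mul_le_mul_right h1 _
      _ = N * L * M ^ (1 / q) * (K ^ (1 / p) * (ENNReal.ofReal (r ^ (α - (n : ℝ) - 1)) *
            ENNReal.ofReal (r ^ (n : ℝ)) ^ (1 / q))) := by
          rw [ENNReal.mul_rpow_of_nonneg _ _ (by positivity : 0 ≤ 1 / q),
            ENNReal.mul_rpow_of_nonneg _ _ (by positivity : 0 ≤ 1 / q)]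
          ring
      _ = _ := by rw [hexp r hr]
  have hnear : ∫⁻ r in Set.Ioo (0 : ℝ) δ, ENNReal.ofReal (r ^ (α - (n : ℝ) - 1)) *
      ∫⁻ y, G y * (μ.restrict E) (cylinder y r) ≤
      N * L * M ^ (1 / q) * (((c₀ * D * Φ δ : ℝ≥0) : ℝ≥0∞) ^ (1 / p) *
        (cI * ENNReal.ofReal ((δ : ℝ) ^ (-b)))) := by
    have hroot : ∀ r : ℝ, 0 < r → ∀ a : ℝ≥0, ENNReal.ofReal (((a : ℝ) / r ^ d) ^ (1 / p)) =
        (a : ℝ≥0∞) ^ (1 / p) * ENNReal.ofReal (r ^ (-b)) := by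
      intro r hr a
      rw [Real.div_rpow a.coe_nonneg (by positivity), ← Real.rpow_mul hr.le, div_eq_mul_inv,
        ← Real.rpow_neg hr.le, ENNReal.ofReal_mul (by positivity),
        ← ENNReal.ofReal_rpow_of_nonneg a.coe_nonneg (by positivity), ENNReal.ofReal_coe_nnreal]
      congr 3
      rw [hb]
      ring
    calc _ ≤ ∫⁻ r in Set.Ioo (0 : ℝ) δ, N * L * M ^ (1 / q) * (((c₀ * D : ℝ≥0) : ℝ≥0∞) ^ (1 / p) *
            ENNReal.ofReal (((Φ r.toNNReal : ℝ) / r ^ d) ^ (1 / p) / r)) := by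
          refine setLIntegral_mono' measurableSet_Ioo fun r hr => ?_
          have hr0 : 0 < r := hr.1
          refine (hslice r hr0 ((c₀ * D * Φ r.toNNReal : ℝ≥0) : ℝ≥0∞) fun y => ?_).trans_eq ?_
          · calc (μ.restrict E) (cylinder y r) ≤ μ (tent (Metric.ball y (4 * r))) :=
                  (Measure.restrict_apply_le _ _).trans (measure_mono (cylinder_subset_tent y r))
              _ ≤ c₀ * (Φ (4 * r.toNNReal) : ℝ≥0∞) := by
                  have := hc₀ y (4 * r.toNNReal) (by
                    have := Real.toNNReal_pos.2 hr0
                    positivity)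
                  push_cast at this
                  rwa [Real.coe_toNNReal _ hr0.le] at this
              _ ≤ _ := by
                  rw [← ENNReal.coe_mul, ENNReal.coe_le_coe, mul_assoc]
                  gcongr
                  exact hD _
          · have e1 : ENNReal.ofReal (((Φ r.toNNReal : ℝ) / r ^ d) ^ (1 / p) / r) =
                (Φ r.toNNReal : ℝ≥0∞) ^ (1 / p) * ENNReal.ofReal (r ^ (-b - 1)) := by
              rw [div_eq_mul_inv _ r, ENNReal.ofReal_mul (by positivity), hroot r hr0, mul_assoc,
                ← ENNReal.ofReal_mul (by positivity), Real.rpow_sub_one hr0.ne',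
                div_eq_mul_inv (r ^ (-b))]
            rw [e1, ENNReal.coe_mul, ENNReal.mul_rpow_of_nonneg _ _ (by positivity : 0 ≤ 1 / p)]
            ring
      _ = N * L * M ^ (1 / q) * (((c₀ * D : ℝ≥0) : ℝ≥0∞) ^ (1 / p)) *
            ∫⁻ r in Set.Ioo (0 : ℝ) δ,
              ENNReal.ofReal (((Φ r.toNNReal : ℝ) / r ^ d) ^ (1 / p) / r) := by
          rw [← lintegral_const_mul' _ _ (ENNReal.mul_ne_top hconst
            (ENNReal.rpow_ne_top_of_nonneg (by positivity) ENNReal.coe_ne_top))]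
          simp only [mul_assoc]
      _ ≤ N * L * M ^ (1 / q) * (((c₀ * D : ℝ≥0) : ℝ≥0∞) ^ (1 / p)) *
            (cI * ENNReal.ofReal (((Φ δ : ℝ) / (δ : ℝ) ^ d) ^ (1 / p))) := by
          gcongr
          exact hcI δ hδ
      _ = _ := by
          rw [hroot _ hδ', ENNReal.coe_mul (c₀ * D),
            ENNReal.mul_rpow_of_nonneg _ _ (by positivity : 0 ≤ 1 / p)]
          ring
  have hfar : ∫⁻ r in Set.Ioi (δ : ℝ), ENNReal.ofReal (r ^ (α - (n : ℝ) - 1)) *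
      ∫⁻ y, G y * (μ.restrict E) (cylinder y r) ≤
      N * L * M ^ (1 / q) * (M ^ (1 / p) * (ENNReal.ofReal (1 / b) * ENNReal.ofReal ((δ : ℝ) ^ (-b)))) := by
    calc _ ≤ ∫⁻ r in Set.Ioi (δ : ℝ), N * L * M ^ (1 / q) * M ^ (1 / p) *
            ENNReal.ofReal (r ^ (-b - 1)) := by
          refine setLIntegral_mono' measurableSet_Ioi fun r hr => ?_
          refine (hslice r (hδ'.trans hr) M fun y => ?_).trans_eq (by ring)
          refine (measure_mono (Set.subset_univ _)).trans_eq ?_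
          rw [Measure.restrict_apply_univ]
      _ = N * L * M ^ (1 / q) * M ^ (1 / p) * ENNReal.ofReal (1 / b * (δ : ℝ) ^ (-b)) := by
          rw [lintegral_const_mul _ (by fun_prop),
            lintegral_Ioi_ofReal_rpow (by linarith) hδ']
          congr 2
          rw [sub_add_cancel]
          field_simp
      _ = _ := by
          rw [ENNReal.ofReal_mul (by positivity)]
          ring
  have htot : M ≤ A * N * ENNReal.ofReal ((δ : ℝ) ^ (-b)) * M ^ (1 / q) *
      (((c₀ * D * Φ δ : ℝ≥0) : ℝ≥0∞) ^ (1 / p) + M ^ (1 / p)) := by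
    have h1 := measure_le_lintegral_cylinder (α := α) hE hfin hG hlow
    have hsub : Set.Ioi (0 : ℝ) ⊆ Set.Ioc (0 : ℝ) δ ∪ Set.Ioi (δ : ℝ) := by
      rw [Set.Ioc_union_Ioi_eq_Ioi hδ'.le]
    have h2 := (lintegral_mono_set (μ := volume) (f := fun r : ℝ =>
      ENNReal.ofReal (r ^ (α - (n : ℝ) - 1)) * ∫⁻ y, G y * (μ.restrict E) (cylinder y r))
      hsub).trans (lintegral_union_le _ _ _)
    rw [setLIntegral_congr Ioo_ae_eq_Ioc.symm] at h2
    have hLc : (L.toNNReal : ℝ≥0∞) = L := ENNReal.coe_toNNReal hLt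
    have hAc : (A : ℝ≥0∞) = C * L * (cI + ENNReal.ofReal (1 / b)) := by
      rw [hA, ENNReal.coe_mul, ENNReal.coe_mul, hLc, ENNReal.coe_add]
      rfl
    calc M ≤ _ := h1
      _ ≤ C * (_ + _) := mul_le_mul_right (h2.trans (add_le_add hnear hfar)) _
      _ = C * L * N * ENNReal.ofReal ((δ : ℝ) ^ (-b)) * M ^ (1 / q) *
          (cI * ((c₀ * D * Φ δ : ℝ≥0) : ℝ≥0∞) ^ (1 / p) +
            ENNReal.ofReal (1 / b) * M ^ (1 / p)) := by ring
      _ ≤ C * L * N * ENNReal.ofReal ((δ : ℝ) ^ (-b)) * M ^ (1 / q) *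
          ((cI + ENNReal.ofReal (1 / b)) * ((c₀ * D * Φ δ : ℝ≥0) : ℝ≥0∞) ^ (1 / p) +
            (cI + ENNReal.ofReal (1 / b)) * M ^ (1 / p)) := by
          gcongr
          · exact le_self_add
          · exact le_add_self
      _ = _ := by
          rw [hAc]
          ring
  have := le_of_le_half_mul_add hpq hfin hsmall htot
  rwa [ENNReal.coe_mul] at this

/-- A measure in `C^Φ` is finite on tents over balls, so `TO` is an increasing union of sets of
finite measure. -/
theorem measure_tent_le_of_truncations {n : ℕ} {Φ : ℝ≥0 → ℝ≥0} {μ : Measure (UpperHalf n)}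
    (hμ : μ ∈ carlesonClass Φ) {O : Set (Euc n)} (hO : IsOpen O) {B : ℝ≥0∞}
    (h : ∀ E ⊆ tent O, MeasurableSet E → μ E ≠ ∞ → μ E ≤ B) : μ (tent O) ≤ B := by
  obtain ⟨c, hc⟩ := hμ
  let E : ℕ → Set (UpperHalf n) := fun R => tent O ∩ {z | dist z.1.1 0 + z.1.2 < (R : ℝ) + 1}
  have hE : ∀ R, MeasurableSet (E R) := by
    intro R
    refine (isOpen_tent hO).measurableSet.inter (IsOpen.measurableSet ?_)
    refine isOpen_lt ?_ continuous_const
    fun_prop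
  have hmono : Monotone E := by
    intro R R' hR z hz
    have h1 : dist z.1.1 0 + z.1.2 < (R : ℝ) + 1 := hz.2
    have h2 : (R : ℝ) ≤ R' := by exact_mod_cast hR
    exact ⟨hz.1, show dist z.1.1 0 + z.1.2 < (R' : ℝ) + 1 by linarith⟩
  have hU : tent O = ⋃ R, E R := by
    refine Set.Subset.antisymm (fun z hz => ?_) (Set.iUnion_subset fun R => Set.inter_subset_left)
    obtain ⟨R, hR⟩ := exists_nat_gt (dist z.1.1 0 + z.1.2)
    exact Set.mem_iUnion.2 ⟨R, hz, hR.trans (by simp)⟩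
  rw [hU, hmono.measure_iUnion]
  refine iSup_le fun R => h _ Set.inter_subset_left (hE R) ?_
  have h1 : E R ⊆ tent (Metric.ball 0 ((R + 1 : ℝ≥0) : ℝ)) := by
    intro z hz
    refine mem_tent_ball ?_
    push_cast
    exact hz.2
  exact ((measure_mono h1).trans (hc 0 (R + 1) (by positivity))).trans_lt
    (ENNReal.mul_lt_top ENNReal.coe_lt_top ENNReal.coe_lt_top) |>.ne

theorem measure_tent_le_of_rieszCap_lt {n : ℕ} (hn : 0 < n) {α p d : ℝ} (hα : 0 < α)
    (hαn : α < n) (hp : 1 < p) (hd : 0 < d) (hdef : d = n - α * p) {Φ : ℝ≥0 → ℝ≥0}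
    (hdil : ∀ c : ℝ≥0, 0 < c → ∃ C : ℝ≥0, ∀ s, Φ (c * s) ≤ C * Φ s)
    (hint : DiniCondition Φ d p) {μ : Measure (UpperHalf n)} (hμ : μ ∈ carlesonClass Φ) :
    ∃ C : ℝ≥0, ∀ (O : Set (Euc n)) (S : ℝ≥0), IsOpen O → 0 < S →
      rieszCap α p O < (S : ℝ≥0∞) ^ d → μ (tent O) ≤ C * Φ S := by
  have hp0 : 0 < p := by linarith
  obtain ⟨C, hC⟩ := one_le_truncated_potential hn hα hαn
  obtain ⟨A, C', hA⟩ := exists_measure_le_gauge hn hp hd hdef hdil hint hμ C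
  set b := d / p with hb
  have hb0 : 0 < b := by positivity
  -- With `δ = l * S` and `‖g‖_p < S ^ b`, the smallness quantity is at most `A / (2 * A + 1) ≤ 1 /
  -- 2`.
  set l : ℝ≥0 := (2 * A + 1) ^ (1 / b) with hl
  have hl0 : 0 < l := NNReal.rpow_pos (by positivity)
  obtain ⟨D, hD⟩ := hdil l hl0
  refine ⟨C' * D, fun O S hO hS hcap => ?_⟩
  have hS' : (0 : ℝ) < S := hS
  simp only [rieszCap, iInf_lt_iff] at hcap
  obtain ⟨f, -, hf1, hf⟩ := hcap
  have hSd : (S : ℝ≥0∞) ^ d = ((S : ℝ≥0∞) ^ b) ^ p := by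
    rw [← ENNReal.rpow_mul, hb, div_mul_cancel₀ _ hp0.ne']
  rw [hSd, ENNReal.rpow_lt_rpow_iff hp0] at hf
  simp only [rieszNorm, iInf_lt_iff] at hf
  obtain ⟨g, hg, hfg, hgS⟩ := hf
  set g' := hg.1.mk g with hg'
  have hgg' : g =ᵐ[volume] g' := hg.1.ae_eq_mk
  set G : Euc n → ℝ≥0∞ := fun y => ‖g' y‖ₑ with hG
  have hGm : Measurable G := hg.1.stronglyMeasurable_mk.measurable.enorm
  have hnorm : (∫⁻ y, G y ^ p) ^ (1 / p) = eLpNorm g (ENNReal.ofReal p) volume := by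
    rw [eLpNorm_eq_lintegral_rpow_enorm_toReal (by simpa using hp0) ENNReal.ofReal_ne_top,
      ENNReal.toReal_ofReal hp0.le]
    congr 1
    refine lintegral_congr_ae ?_
    filter_upwards [hgg'] with y hy
    rw [hy]
  have hGp : ∫⁻ y, G y ^ p ≠ ∞ := by
    intro h
    rw [h, ENNReal.top_rpow_of_pos (by positivity)] at hnorm
    exact hg.2.ne hnorm.symm
  have hlow := hC O G hGm (by
    filter_upwards [hfg] with x hx hxO
    have h1 : (1 : ℝ) ≤ |rieszPotential α g x| := by
      rw [← hx]
      exact (hf1 x hxO).trans (le_abs_self _)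
    have h2 := ENNReal.ofReal_le_ofReal h1
    rw [ENNReal.ofReal_one] at h2
    refine h2.trans ?_
    rw [rieszPotential, abs_mul, ENNReal.ofReal_mul (abs_nonneg _)]
    refine mul_le_mul_right ?_ _
    rw [← Real.norm_eq_abs, ofReal_norm]
    refine (enorm_integral_le_lintegral_enorm _).trans_eq ?_
    refine lintegral_congr_ae ?_
    filter_upwards [hgg'] with y hy
    rw [enorm_mul, hy, ← ofReal_norm (‖x - y‖ ^ _), Real.norm_of_nonneg (by positivity)])
  refine measure_tent_le_of_truncations hμ hO fun E hEO hE hEfin => ?_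
  have h1 := hA E G hE hEfin hGm hGp (fun z hz => hlow z (hEO hz)) (l * S) (by positivity) (by
    rw [hnorm]
    have hN : eLpNorm g (ENNReal.ofReal p) volume ≤ ENNReal.ofReal ((S : ℝ) ^ b) := by
      rw [← ENNReal.ofReal_rpow_of_pos hS', ENNReal.ofReal_coe_nnreal]
      exact hgS.le
    calc _ ≤ ENNReal.ofReal A * ENNReal.ofReal ((S : ℝ) ^ b) *
          ENNReal.ofReal (((l * S : ℝ≥0) : ℝ) ^ (-b)) := by
          rw [ENNReal.ofReal_coe_nnreal]
          gcongr
      _ = ENNReal.ofReal (A * (S : ℝ) ^ b * ((l * S : ℝ≥0) : ℝ) ^ (-b)) := by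
          rw [← ENNReal.ofReal_mul (by positivity), ← ENNReal.ofReal_mul (by positivity)]
      _ ≤ ENNReal.ofReal 2⁻¹ := by
          refine ENNReal.ofReal_le_ofReal ?_
          have hlb : (l : ℝ) ^ b = 2 * A + 1 := by
            rw [hl]
            push_cast
            rw [← Real.rpow_mul (by positivity), one_div_mul_cancel hb0.ne', Real.rpow_one]
          have hSb : (0 : ℝ) < (S : ℝ) ^ b := Real.rpow_pos_of_pos hS' _
          push_cast
          rw [Real.rpow_neg (by positivity), Real.mul_rpow l.coe_nonneg S.coe_nonneg, hlb]
          have hA0 : (0 : ℝ) ≤ A := A.coe_nonneg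
          have : (A : ℝ) * (S : ℝ) ^ b * ((2 * A + 1) * (S : ℝ) ^ b)⁻¹ = A / (2 * A + 1) := by
            field_simp
          rw [this, div_le_iff₀ (by positivity)]
          linarith
      _ = 2⁻¹ := by
          rw [ENNReal.ofReal_inv_of_pos two_pos]
          simp)
  refine h1.trans ?_
  rw [ENNReal.coe_mul, mul_assoc]
  gcongr
  exact_mod_cast hD S

/-! ### The Gaussian as a Schwartz function -/

theorem exists_one_add_pow_mul_exp_neg_sq_le (N : ℕ) :
    ∃ C : ℝ, ∀ y : ℝ, 0 ≤ y → (1 + y) ^ N * Real.exp (-y ^ 2) ≤ C := by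
  refine ⟨N.factorial * Real.exp 2, fun y hy => ?_⟩
  have h1 := Real.pow_div_factorial_le_exp (1 + y) (by positivity) N
  rw [div_le_iff₀ (by positivity)] at h1
  calc (1 + y) ^ N * Real.exp (-y ^ 2) ≤ Real.exp (1 + y) * N.factorial * Real.exp (-y ^ 2) := by
        gcongr
    _ = N.factorial * Real.exp (1 + y + -y ^ 2) := by rw [Real.exp_add (1 + y)]; ring
    _ ≤ N.factorial * Real.exp 2 := by
        gcongr
        nlinarith [sq_nonneg (y - 1)]

/-- The Gaussian `exp (-‖x‖ ^ 2)` as a Schwartz function. -/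
def gaussianSchwartz (E : Type*) [NormedAddCommGroup E] [InnerProductSpace ℝ E] : 𝓢(E, ℝ) where
  toFun x := Real.exp (-‖x‖ ^ 2)
  smooth' := (contDiff_norm_sq ℝ).neg.exp
  decay' m j := by
    have htg : (fun x : E => -‖x‖ ^ 2).HasTemperateGrowth :=
      (Function.hasTemperateGrowth_norm_sq (H := E)).neg
    obtain ⟨k, C, hC0, hC⟩ := htg.norm_iteratedFDeriv_le_uniform j
    obtain ⟨K, hK⟩ := exists_one_add_pow_mul_exp_neg_sq_le (m + k * j)
    refine ⟨j.factorial * (C + 1) ^ j * K, fun x => ?_⟩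
    have hx1 : 1 ≤ (1 + ‖x‖) ^ k := one_le_pow₀ (by linarith [norm_nonneg x])
    -- The composition estimate wants the `i`-th derivative bounded by an `i`-th power; a base at
    -- least `1` makes this automatic for `i ≥ 1`.
    have hD : (1 : ℝ) ≤ (C + 1) * (1 + ‖x‖) ^ k := by nlinarith
    have h1 : ‖iteratedFDeriv ℝ j (Real.exp ∘ fun x : E => -‖x‖ ^ 2) x‖ ≤
        j.factorial * Real.exp (-‖x‖ ^ 2) * ((C + 1) * (1 + ‖x‖) ^ k) ^ j := by
      refine norm_iteratedFDeriv_comp_le (N := (j : ℕ∞)) Real.contDiff_exp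
        (htg.1.of_le (by exact_mod_cast le_top)) le_rfl x (fun i _ => ?_) (fun i hi hij => ?_)
      · rw [norm_iteratedFDeriv_eq_norm_iteratedDeriv, iteratedDeriv_eq_iterate, Real.iter_deriv_exp]
        simp
      · calc _ ≤ C * (1 + ‖x‖) ^ k := hC i hij x
          _ ≤ (C + 1) * (1 + ‖x‖) ^ k := by gcongr; linarith
          _ ≤ _ := le_self_pow₀ hD (by omega)
    calc ‖x‖ ^ m * ‖iteratedFDeriv ℝ j (fun x : E => Real.exp (-‖x‖ ^ 2)) x‖
        ≤ (1 + ‖x‖) ^ m * (j.factorial * Real.exp (-‖x‖ ^ 2) *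
            ((C + 1) * (1 + ‖x‖) ^ k) ^ j) := by
          gcongr
          · linarith
          · exact h1
      _ = j.factorial * (C + 1) ^ j * ((1 + ‖x‖) ^ (m + k * j) * Real.exp (-‖x‖ ^ 2)) := by
          rw [mul_pow, pow_add, pow_mul]
          ring
      _ ≤ _ := by
          gcongr
          exact hK _ (norm_nonneg _)

/-! ### Time derivatives of the heat kernel -/

/-- The polynomials with `∂_s^k (s^(-m) e^(-ρ/s)) = s^(-m-k) P_k(ρ/s) e^(-ρ/s)`. -/
def heatPoly (m : ℝ) : ℕ → Polynomial ℝ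
  | 0 => 1
  | k + 1 => (Polynomial.X - Polynomial.C (m + k)) * heatPoly m k -
      Polynomial.X * Polynomial.derivative (heatPoly m k)

/-- The `k`-th derivative in `s` of `s ^ (-m) * exp (-ρ / s)`. -/
def heatDeriv (m : ℝ) (k : ℕ) (ρ s : ℝ) : ℝ :=
  s ^ (-(m + k)) * ((heatPoly m k).eval (ρ / s) * Real.exp (-(ρ / s)))

theorem heatDeriv_zero (m ρ s : ℝ) : heatDeriv m 0 ρ s = s ^ (-m) * Real.exp (-(ρ / s)) := by
  simp [heatDeriv, heatPoly]

/-- With `u = ρ / s` one has `s ∂_s u = -u`, so the product rule yields the recursion of `heatPoly`.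
-/
theorem hasDerivAt_heatDeriv (m : ℝ) (k : ℕ) (ρ : ℝ) {s : ℝ} (hs : 0 < s) :
    HasDerivAt (heatDeriv m k ρ) (heatDeriv m (k + 1) ρ s) s := by
  have h1 : HasDerivAt (fun s : ℝ => s ^ (-(m + k))) (-(m + k) * s ^ (-(m + k) - 1)) s :=
    Real.hasDerivAt_rpow_const (Or.inl hs.ne')
  have h2 : HasDerivAt (fun s : ℝ => ρ / s) (-(ρ / s ^ 2)) s := by
    have := (hasDerivAt_inv hs.ne').const_mul ρ
    simpa [div_eq_mul_inv] using this
  have h3 := ((heatPoly m k).hasDerivAt (ρ / s)).comp s h2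
  have h4 := h2.neg.exp
  have h5 := h1.mul (h3.mul h4)
  refine h5.congr_deriv ?_
  have e1 : s ^ (-(m + k)) = s * s ^ (-(m + k) - 1) := by
    rw [Real.rpow_sub_one hs.ne']
    field_simp
  have e2 : -(m + ((k + 1 : ℕ) : ℝ)) = -(m + k) - 1 := by push_cast; ring
  simp only [heatDeriv, heatPoly, Polynomial.eval_sub, Polynomial.eval_mul, Polynomial.eval_X,
    Polynomial.eval_C, Function.comp, Pi.mul_apply, Pi.neg_apply]
  rw [e2, e1]
  field_simp
  ring

theorem exists_abs_eval_le_exp (P : Polynomial ℝ) :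
    ∃ C : ℝ, 0 ≤ C ∧ ∀ u : ℝ, 0 ≤ u → |P.eval u| ≤ C * Real.exp (u / 2) := by
  induction P using Polynomial.induction_on' with
  | add p q hp hq =>
    obtain ⟨C, hC0, hC⟩ := hp
    obtain ⟨D, hD0, hD⟩ := hq
    refine ⟨C + D, by positivity, fun u hu => ?_⟩
    rw [Polynomial.eval_add, add_mul]
    exact (abs_add_le _ _).trans (add_le_add (hC u hu) (hD u hu))
  | monomial j a =>
    refine ⟨|a| * (2 ^ j * j.factorial), by positivity, fun u hu => ?_⟩
    have h1 := Real.pow_div_factorial_le_exp (u / 2) (by positivity) j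
    rw [div_le_iff₀ (by positivity), div_pow, div_le_iff₀ (by positivity)] at h1
    rw [Polynomial.eval_monomial, abs_mul, abs_of_nonneg (pow_nonneg hu j), mul_assoc]
    gcongr
    linarith

/-- Half of the exponential absorbs the polynomial; the other half is the heat kernel at time `2 s`.
Derivatives are thus dominated by a positive kernel of known mass. -/
theorem exists_abs_heatDeriv_le (m : ℝ) (k : ℕ) :
    ∃ C : ℝ, 0 ≤ C ∧ ∀ ρ s : ℝ, 0 ≤ ρ → 0 < s →
      |heatDeriv m k ρ s| ≤ C * s ^ (-(k : ℝ)) * heatDeriv m 0 ρ (2 * s) := by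
  obtain ⟨C, hC0, hC⟩ := exists_abs_eval_le_exp (heatPoly m k)
  refine ⟨C * 2 ^ m, by positivity, fun ρ s hρ hs => ?_⟩
  have hu : 0 ≤ ρ / s := by positivity
  rw [heatDeriv_zero, heatDeriv, abs_mul, abs_mul, abs_of_pos (Real.exp_pos _),
    abs_of_pos (Real.rpow_pos_of_pos hs _)]
  have e1 : s ^ (-(m + k)) = s ^ (-(k : ℝ)) * s ^ (-m) := by
    rw [← Real.rpow_add hs]
    congr 1
    ring
  have e2 : (2 * s) ^ (-m) = 2 ^ (-m) * s ^ (-m) := Real.mul_rpow (by norm_num) hs.le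
  have e3 : (2 : ℝ) ^ m * 2 ^ (-m) = 1 := by
    rw [← Real.rpow_add two_pos]
    simp
  calc s ^ (-(m + k)) * (|(heatPoly m k).eval (ρ / s)| * Real.exp (-(ρ / s)))
      ≤ s ^ (-(m + k)) * (C * Real.exp (ρ / s / 2) * Real.exp (-(ρ / s))) := by
        gcongr
        exact hC _ hu
    _ = s ^ (-(k : ℝ)) * s ^ (-m) * C * Real.exp (-(ρ / (2 * s))) := by
        have : Real.exp (ρ / s / 2) * Real.exp (-(ρ / s)) = Real.exp (-(ρ / (2 * s))) := by
          rw [← Real.exp_add]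
          congr 1
          field_simp
          ring
        rw [e1, mul_assoc C, this]
        ring
    _ = C * (2 ^ m * 2 ^ (-m)) * s ^ (-(k : ℝ)) * (s ^ (-m) * Real.exp (-(ρ / (2 * s)))) := by
        rw [e3]
        ring
    _ = _ := by
        rw [e2]
        ring

theorem heatDeriv_zero_le {m ρ s : ℝ} (hρ : 0 ≤ ρ) (hs : 0 < s) :
    heatDeriv m 0 ρ s ≤ s ^ (-m) := by
  rw [heatDeriv_zero]
  refine mul_le_of_le_one_right (by positivity) (Real.exp_le_one_iff.2 ?_)
  have : 0 ≤ ρ / s := by positivity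
  linarith

theorem heatDeriv_zero_nonneg {m ρ s : ℝ} (hs : 0 < s) : 0 ≤ heatDeriv m 0 ρ s := by
  rw [heatDeriv_zero]
  positivity

theorem exists_abs_heatDeriv_le_rpow (m : ℝ) (k : ℕ) :
    ∃ C : ℝ, 0 ≤ C ∧ ∀ ρ s : ℝ, 0 ≤ ρ → 0 < s → |heatDeriv m k ρ s| ≤ C * s ^ (-(m + k)) := by
  obtain ⟨C, hC0, hC⟩ := exists_abs_heatDeriv_le m k
  refine ⟨C * 2 ^ (-m), by positivity, fun ρ s hρ hs => (hC ρ s hρ hs).trans ?_⟩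
  calc C * s ^ (-(k : ℝ)) * heatDeriv m 0 ρ (2 * s) ≤ C * s ^ (-(k : ℝ)) * (2 * s) ^ (-m) := by
        gcongr
        exact heatDeriv_zero_le hρ (by positivity)
    _ = C * 2 ^ (-m) * s ^ (-(m + k)) := by
        rw [Real.mul_rpow (by norm_num) hs.le, neg_add, Real.rpow_add hs]
        ring

theorem measurable_heatDeriv (m : ℝ) (k : ℕ) :
    Measurable fun q : ℝ × ℝ => heatDeriv m k q.1 q.2 := by
  have h : Measurable fun q : ℝ × ℝ => q.1 / q.2 := measurable_fst.div measurable_snd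
  exact (measurable_snd.pow_const _).mul
    (((heatPoly m k).continuous.measurable.comp h).mul h.neg.exp)

/-- The substitution `r ↦ 1 / r` gives a Gamma integral. With `m = n / 2` and `ρ = ‖x‖ ^ 2` it
exhibits the Riesz kernel as a superposition of heat kernels. -/
theorem integral_Ioi_rpow_mul_heatDeriv {m a : ℝ} (ham : a < m) {ρ : ℝ} (hρ : 0 < ρ) :
    ∫ r in Set.Ioi (0 : ℝ), r ^ (a - 1) * heatDeriv m 0 ρ r =
      ρ ^ (a - m) * Real.Gamma (m - a) := by
  have h1 := Real.integral_rpow_mul_exp_neg_mul_Ioi (a := m - a) (r := ρ) (by linarith) hρ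
  rw [← integral_comp_rpow_Ioi _ (show (-1 : ℝ) ≠ 0 by norm_num)] at h1
  rw [one_div, Real.inv_rpow hρ.le, ← Real.rpow_neg hρ.le, neg_sub] at h1
  rw [← h1]
  refine setIntegral_congr_fun measurableSet_Ioi fun r hr => ?_
  have hr0 : 0 < r := hr
  simp only [heatDeriv_zero, smul_eq_mul, abs_neg, abs_one, one_mul]
  rw [← Real.rpow_mul hr0.le, ← mul_assoc, ← mul_assoc, ← Real.rpow_add hr0, ← Real.rpow_add hr0,
    Real.rpow_neg_one, div_eq_mul_inv]
  congr 2
  ring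

/-! ### The heat semigroup -/

theorem integral_heatDeriv_zero {n : ℕ} {s : ℝ} (hs : 0 < s) :
    ∫ y : Euc n, heatDeriv (n / 2) 0 (‖y‖ ^ 2) s = Real.pi ^ ((n : ℝ) / 2) := by
  have h := GaussianFourier.integral_rexp_neg_mul_sq_norm (V := Euc n) (inv_pos.2 hs)
  rw [finrank_euclideanSpace_fin] at h
  simp only [heatDeriv_zero]
  rw [integral_const_mul]
  have e : ∀ y : Euc n, Real.exp (-(‖y‖ ^ 2 / s)) = Real.exp (-s⁻¹ * ‖y‖ ^ 2) := fun y => by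
    congr 1
    field_simp
  simp_rw [e]
  rw [h, div_inv_eq_mul, Real.mul_rpow Real.pi_pos.le hs.le, mul_comm (Real.pi ^ _), ← mul_assoc,
    ← Real.rpow_add hs]
  simp

theorem integrable_heatDeriv_zero {n : ℕ} {s : ℝ} (hs : 0 < s) :
    Integrable fun y : Euc n => heatDeriv (n / 2) 0 (‖y‖ ^ 2) s := by
  refine Integrable.of_integral_ne_zero ?_
  rw [integral_heatDeriv_zero hs]
  exact (Real.rpow_pos_of_pos Real.pi_pos _).ne'

theorem norm_sq_div_add_norm_sq_div {n : ℕ} (x y : Euc n) {r s : ℝ} (hr : 0 < r) (hs : 0 < s) :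
    ‖x - y‖ ^ 2 / r + ‖y‖ ^ 2 / s =
      ‖y - (s / (r + s)) • x‖ ^ 2 / (r * s / (r + s)) + ‖x‖ ^ 2 / (r + s) := by
  rw [norm_sub_sq_real, norm_sub_sq_real, inner_smul_right, norm_smul, real_inner_comm y x,
    Real.norm_of_nonneg (by positivity)]
  have : r + s ≠ 0 := by positivity
  field_simp
  ring

/-- Semigroup law by completing the square in `y`. The kernels are not normalized; the factor is
their common mass. -/
theorem integral_heat_mul_heat {n : ℕ} (x : Euc n) {r s : ℝ} (hr : 0 < r) (hs : 0 < s) :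
    ∫ y : Euc n, heatDeriv (n / 2) 0 (‖x - y‖ ^ 2) r * heatDeriv (n / 2) 0 (‖y‖ ^ 2) s =
      Real.pi ^ ((n : ℝ) / 2) * heatDeriv (n / 2) 0 (‖x‖ ^ 2) (r + s) := by
  have hrs : 0 < r + s := by positivity
  have hq : 0 < r * s / (r + s) := by positivity
  have e : ∀ y : Euc n,
      heatDeriv (n / 2) 0 (‖x - y‖ ^ 2) r * heatDeriv (n / 2) 0 (‖y‖ ^ 2) s =
      heatDeriv (n / 2) 0 (‖x‖ ^ 2) (r + s) *
        heatDeriv (n / 2) 0 (‖y - (s / (r + s)) • x‖ ^ 2) (r * s / (r + s)) := by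
    intro y
    simp only [heatDeriv_zero]
    have h1 : Real.exp (-(‖x - y‖ ^ 2 / r)) * Real.exp (-(‖y‖ ^ 2 / s)) =
        Real.exp (-(‖x‖ ^ 2 / (r + s))) *
          Real.exp (-(‖y - (s / (r + s)) • x‖ ^ 2 / (r * s / (r + s)))) := by
      rw [← Real.exp_add, ← Real.exp_add, ← neg_add, ← neg_add,
        norm_sq_div_add_norm_sq_div x y hr hs, add_comm (‖x‖ ^ 2 / (r + s))]
    have h2 : r ^ (-((n : ℝ) / 2)) * s ^ (-((n : ℝ) / 2)) =
        (r + s) ^ (-((n : ℝ) / 2)) * (r * s / (r + s)) ^ (-((n : ℝ) / 2)) := by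
      rw [← Real.mul_rpow hr.le hs.le, ← Real.mul_rpow hrs.le hq.le]
      congr 1
      field_simp
    calc _ = (r ^ (-((n : ℝ) / 2)) * s ^ (-((n : ℝ) / 2))) *
          (Real.exp (-(‖x - y‖ ^ 2 / r)) * Real.exp (-(‖y‖ ^ 2 / s))) := by ring
      _ = _ := by
        rw [h1, h2]
        ring
  simp_rw [e]
  rw [integral_const_mul, integral_sub_right_eq_self
    (fun y : Euc n => heatDeriv (n / 2) 0 (‖y‖ ^ 2) (r * s / (r + s))),
    integral_heatDeriv_zero hq, mul_comm]

theorem measurable_heatDeriv_norm {n : ℕ} (m : ℝ) (k : ℕ) (x : Euc n) (s : ℝ) :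
    Measurable fun y : Euc n => heatDeriv m k (‖x - y‖ ^ 2) s :=
  (measurable_heatDeriv m k).comp
    (((measurable_id.const_sub x).norm.pow_const 2).prodMk measurable_const)

theorem measurable_heatDeriv_norm_zero {n : ℕ} (m : ℝ) (k : ℕ) (s : ℝ) :
    Measurable fun y : Euc n => heatDeriv m k (‖y‖ ^ 2) s :=
  (measurable_heatDeriv m k).comp ((measurable_norm.pow_const 2).prodMk measurable_const)

theorem integrable_heat_sub {n : ℕ} (x : Euc n) {r : ℝ} (hr : 0 < r) :
    Integrable fun y : Euc n => heatDeriv (n / 2) 0 (‖x - y‖ ^ 2) r :=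
  (integrable_heatDeriv_zero hr).comp_sub_left x

theorem integrable_heat_mul_heatDeriv {n : ℕ} (x : Euc n) (k : ℕ) {r s : ℝ} (hr : 0 < r)
    (hs : 0 < s) :
    Integrable fun y : Euc n =>
      heatDeriv (n / 2) 0 (‖x - y‖ ^ 2) r * heatDeriv (n / 2) k (‖y‖ ^ 2) s := by
  obtain ⟨C, -, hC⟩ := exists_abs_heatDeriv_le_rpow (n / 2) k
  exact (integrable_heat_sub x hr).mul_bdd (c := C * s ^ (-((n : ℝ) / 2 + k)))
    (measurable_heatDeriv_norm_zero _ _ _).aestronglyMeasurable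
    (ae_of_all _ fun y => hC _ _ (by positivity) hs)

/-- The semigroup law differentiated `k` times in `s` under the integral; near `s` the times stay
above `s / 2`, which gives the dominating function. -/
theorem integral_heat_mul_heatDeriv {n : ℕ} (x : Euc n) (k : ℕ) {r s : ℝ} (hr : 0 < r)
    (hs : 0 < s) :
    ∫ y : Euc n, heatDeriv (n / 2) 0 (‖x - y‖ ^ 2) r * heatDeriv (n / 2) k (‖y‖ ^ 2) s =
      Real.pi ^ ((n : ℝ) / 2) * heatDeriv (n / 2) k (‖x‖ ^ 2) (r + s) := by
  induction k generalizing s with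
  | zero => exact integral_heat_mul_heat x hr hs
  | succ k ih =>
    obtain ⟨C, hC0, hC⟩ := exists_abs_heatDeriv_le_rpow (n / 2) (k + 1)
    have hball : ∀ s' ∈ Metric.ball s (s / 2), s / 2 < s' := by
      intro s' hs'
      rw [Metric.mem_ball, Real.dist_eq, abs_lt] at hs'
      linarith [hs'.1]
    have hD := (hasDerivAt_integral_of_dominated_loc_of_deriv_le (μ := (volume : Measure (Euc n)))
      (F := fun s y => heatDeriv (n / 2) 0 (‖x - y‖ ^ 2) r * heatDeriv (n / 2) k (‖y‖ ^ 2) s)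
      (F' := fun s y => heatDeriv (n / 2) 0 (‖x - y‖ ^ 2) r * heatDeriv (n / 2) (k + 1) (‖y‖ ^ 2) s)
      (x₀ := s) (s := Metric.ball s (s / 2))
      (bound := fun y => heatDeriv (n / 2) 0 (‖x - y‖ ^ 2) r *
        (C * (s / 2) ^ (-((n : ℝ) / 2 + (k + 1 : ℕ)))))
      (Metric.ball_mem_nhds _ (by positivity))
      (Filter.Eventually.of_forall fun s' => ((measurable_heatDeriv_norm _ _ _ _).mul
        (measurable_heatDeriv_norm_zero _ _ _)).aestronglyMeasurable)
      (integrable_heat_mul_heatDeriv x k hr hs)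
      ((measurable_heatDeriv_norm _ _ _ _).mul
        (measurable_heatDeriv_norm_zero _ _ _)).aestronglyMeasurable
      (ae_of_all _ fun y s' hs' => by
        have h1 := hball s' hs'
        have h2 : 0 < s / 2 := by positivity
        rw [norm_mul, Real.norm_of_nonneg (heatDeriv_zero_nonneg hr)]
        refine mul_le_mul_of_nonneg_left ?_ (heatDeriv_zero_nonneg hr)
        refine (hC _ _ (by positivity) (h2.trans h1)).trans ?_
        refine mul_le_mul_of_nonneg_left ?_ hC0
        exact Real.rpow_le_rpow_of_nonpos h2 h1.le (neg_nonpos.2 (by positivity)))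
      ((integrable_heat_sub x hr).mul_const _)
      (ae_of_all _ fun y s' hs' =>
        (hasDerivAt_heatDeriv _ _ _ ((half_pos hs).trans (hball s' hs'))).const_mul _)).2
    have hR : HasDerivAt (fun s => Real.pi ^ ((n : ℝ) / 2) * heatDeriv (n / 2) k (‖x‖ ^ 2) (r + s))
        (Real.pi ^ ((n : ℝ) / 2) * heatDeriv (n / 2) (k + 1) (‖x‖ ^ 2) (r + s)) s :=
      (HasDerivAt.comp_const_add r s
        (hasDerivAt_heatDeriv _ k (‖x‖ ^ 2) (by positivity : 0 < r + s))).const_mul _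
    refine hD.unique (hR.congr_of_eventuallyEq ?_)
    filter_upwards [lt_mem_nhds hs] with s' hs'
    exact ih hs'

/-! ### One-dimensional integrals -/

theorem integrableOn_rpow_mul_one_add_rpow {b c : ℝ} (hb : 0 < b) (hbc : b < c) :
    IntegrableOn (fun t : ℝ => t ^ (b - 1) * (1 + t) ^ (-c)) (Set.Ioi 0) := by
  have hm : Measurable fun t : ℝ => t ^ (b - 1) * (1 + t) ^ (-c) := by fun_prop
  rw [← Set.Ioc_union_Ioi_eq_Ioi (zero_le_one' ℝ)]
  refine IntegrableOn.union ?_ ?_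
  · have h1 : IntegrableOn (fun t : ℝ => t ^ (b - 1)) (Set.Ioc 0 1) := by
      rw [integrableOn_Ioc_iff_integrableOn_Ioo]
      exact (intervalIntegral.integrableOn_Ioo_rpow_iff one_pos).2 (by linarith)
    refine Integrable.mono' h1 hm.aestronglyMeasurable ?_
    filter_upwards [self_mem_ae_restrict measurableSet_Ioc] with t ht
    have ht0 : 0 < t := ht.1
    rw [Real.norm_of_nonneg (by positivity)]
    refine mul_le_of_le_one_right (by positivity) ?_
    exact Real.rpow_le_one_of_one_le_of_nonpos (by linarith) (by linarith)
  · have h1 : IntegrableOn (fun t : ℝ => t ^ (b - 1 - c)) (Set.Ioi 1) :=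
      integrableOn_Ioi_rpow_of_lt (by linarith) one_pos
    refine Integrable.mono' h1 hm.aestronglyMeasurable ?_
    filter_upwards [self_mem_ae_restrict measurableSet_Ioi] with t ht
    have ht0 : 0 < t := one_pos.trans ht
    rw [Real.norm_of_nonneg (by positivity), sub_eq_add_neg (b - 1), Real.rpow_add ht0]
    refine mul_le_mul_of_nonneg_left ?_ (by positivity)
    exact Real.rpow_le_rpow_of_nonpos ht0 (by linarith) (by linarith)

theorem integrableOn_rpow_mul_heatDeriv {m : ℝ} (j : ℕ) {i : ℝ} (hi : 0 < i)
    (hij : i < m + j) {ρ : ℝ} (hρ : 0 ≤ ρ) :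
    IntegrableOn (fun u : ℝ => u ^ (i - 1) * heatDeriv m j ρ (1 + u)) (Set.Ioi 0) := by
  obtain ⟨C, -, hC⟩ := exists_abs_heatDeriv_le_rpow m j
  refine Integrable.mono' ((integrableOn_rpow_mul_one_add_rpow hi hij).const_mul C)
    (Measurable.aestronglyMeasurable ?_) ?_
  · exact (by fun_prop : Measurable fun u : ℝ => u ^ (i - 1)).mul ((measurable_heatDeriv m j).comp
      (measurable_const.prodMk (measurable_const.add measurable_id)))
  · filter_upwards [self_mem_ae_restrict measurableSet_Ioi] with t ht
    have ht0 : 0 < t := ht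
    rw [norm_mul, Real.norm_of_nonneg (by positivity : 0 ≤ t ^ (i - 1)), mul_left_comm]
    refine mul_le_mul_of_nonneg_left (hC _ _ hρ (by positivity)) (by positivity)

/-- Repeated integration by parts; the boundary terms at infinity vanish because `u ^ l` times the
`l`-th derivative is `O(u ^ (-m))`. -/
theorem integral_pow_mul_heatDeriv {m : ℝ} (hm : 0 < m) {ρ : ℝ} (hρ : 0 ≤ ρ) (j : ℕ) :
    ∫ u in Set.Ioi (0 : ℝ), u ^ j * heatDeriv m (j + 1) ρ (1 + u) =
      (-1) ^ (j + 1) * j.factorial * heatDeriv m 0 ρ 1 := by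
  have hint : ∀ i l : ℕ, i + 1 ≤ l →
      IntegrableOn (fun u : ℝ => u ^ i * heatDeriv m l ρ (1 + u)) (Set.Ioi 0) := by
    intro i l hil
    have h1 : (i : ℝ) + 1 ≤ l := by exact_mod_cast hil
    refine (integrableOn_rpow_mul_heatDeriv (m := m) l (i := (i : ℝ) + 1) (by positivity)
      (by linarith) hρ).congr_fun (fun u _ => ?_) measurableSet_Ioi
    simp
  have hder : ∀ l : ℕ, ∀ u : ℝ, 0 ≤ u →
      HasDerivAt (fun u => heatDeriv m l ρ (1 + u)) (heatDeriv m (l + 1) ρ (1 + u)) u :=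
    fun l u hu => HasDerivAt.comp_const_add 1 u (hasDerivAt_heatDeriv m l ρ (by positivity))
  have hlim : ∀ l : ℕ, Filter.Tendsto (fun u : ℝ => u ^ l * heatDeriv m l ρ (1 + u))
      Filter.atTop (nhds 0) := by
    intro l
    obtain ⟨C, hC0, hC⟩ := exists_abs_heatDeriv_le_rpow m l
    have h0 : Filter.Tendsto (fun u : ℝ => C * u ^ (-m)) Filter.atTop (nhds 0) := by
      simpa using (tendsto_rpow_neg_atTop hm).const_mul C
    refine squeeze_zero_norm' ?_ h0
    filter_upwards [Filter.eventually_gt_atTop 0] with u hu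
    rw [norm_mul, Real.norm_of_nonneg (by positivity : 0 ≤ u ^ l)]
    calc u ^ l * ‖heatDeriv m l ρ (1 + u)‖ ≤ u ^ l * (C * (1 + u) ^ (-(m + l))) := by
          gcongr
          exact hC _ _ hρ (by positivity)
      _ ≤ u ^ l * (C * u ^ (-(m + l))) := by
          gcongr u ^ l * (C * ?_)
          exact Real.rpow_le_rpow_of_nonpos hu (by linarith) (neg_nonpos.2 (by positivity))
      _ = C * u ^ (-m) := by
          rw [neg_add, Real.rpow_add hu, Real.rpow_neg hu.le (l : ℝ), Real.rpow_natCast]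
          field_simp
  induction j with
  | zero =>
    have h := integral_Ioi_of_hasDerivAt_of_tendsto' (a := (0 : ℝ)) (m := 0)
      (f := fun u => heatDeriv m 0 ρ (1 + u)) (f' := fun u => heatDeriv m 1 ρ (1 + u))
      (fun u hu => hder 0 u hu) (by simpa using hint 0 1 le_rfl) (by simpa using hlim 0)
    simpa using h
  | succ j ih =>
    have h := integral_Ioi_of_hasDerivAt_of_tendsto' (a := (0 : ℝ)) (m := 0)
      (f := fun u => u ^ (j + 1) * heatDeriv m (j + 1) ρ (1 + u))
      (f' := fun u => ((j + 1 : ℕ) : ℝ) * (u ^ j * heatDeriv m (j + 1) ρ (1 + u)) +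
        u ^ (j + 1) * heatDeriv m (j + 1 + 1) ρ (1 + u))
      (fun u hu => ((hasDerivAt_pow (j + 1) u).mul (hder (j + 1) u hu)).congr_deriv
        (by simp; ring))
      (((hint j (j + 1) le_rfl).const_mul _).add (hint (j + 1) (j + 1 + 1) le_rfl)) (hlim (j + 1))
    rw [integral_add ((hint j (j + 1) le_rfl).const_mul _) (hint (j + 1) (j + 1 + 1) le_rfl),
      integral_const_mul, ih] at h
    rw [Nat.factorial_succ, pow_succ]
    push_cast at h ⊢
    have h0 : (0 : ℝ) ^ (j + 1) = 0 := by simp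
    rw [h0] at h
    linarith

/-! ### Composition of fractional integrals -/

theorem integral_rpow_mul_sub_rpow {a b u : ℝ} (ha : 0 < a) (hb : 0 < b) (hu : 0 < u) :
    ∫ r in (0 : ℝ)..u, r ^ (a - 1) * (u - r) ^ (b - 1) =
      u ^ (a + b - 1) * ProbabilityTheory.beta a b := by
  have h := Complex.betaIntegral_scaled a b hu
  have h1 : Complex.betaIntegral a b = ((ProbabilityTheory.beta a b : ℝ) : ℂ) := by
    rw [Complex.betaIntegral_eq_Gamma_mul_div _ _ (by simpa) (by simpa), ProbabilityTheory.beta,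
      ← Complex.ofReal_add, Complex.Gamma_ofReal, Complex.Gamma_ofReal, Complex.Gamma_ofReal]
    push_cast
    rfl
  have h2 : ∫ x in (0 : ℝ)..u, (x : ℂ) ^ ((a : ℂ) - 1) * ((u : ℂ) - x) ^ ((b : ℂ) - 1) =
      ((∫ r in (0 : ℝ)..u, r ^ (a - 1) * (u - r) ^ (b - 1) : ℝ) : ℂ) := by
    rw [← intervalIntegral.integral_ofReal]
    refine intervalIntegral.integral_congr_ae (ae_of_all _ fun x hx => ?_)
    rw [Set.uIoc_of_le hu.le] at hx
    rw [Complex.ofReal_mul, Complex.ofReal_cpow hx.1.le, Complex.ofReal_cpow (by linarith [hx.2])]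
    push_cast
    rfl
  rw [h2, h1] at h
  have h3 : (u : ℂ) ^ ((a : ℂ) + b - 1) = ((u ^ (a + b - 1) : ℝ) : ℂ) := by
    rw [Complex.ofReal_cpow hu.le]
    push_cast
    rfl
  rw [h3] at h
  exact_mod_cast h

/-- The kernel `r_+ ^ (c - 1)` of fractional integration. -/
def fracKernel (c : ℝ) : ℝ → ℝ := (Set.Ioi 0).indicator fun r => r ^ (c - 1)

theorem fracKernel_nonneg (c r : ℝ) : 0 ≤ fracKernel c r :=
  Set.indicator_nonneg (fun _ h => Real.rpow_nonneg (le_of_lt h) _) _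

theorem measurable_fracKernel (c : ℝ) : Measurable (fracKernel c) :=
  (measurable_id.pow_const _).indicator measurableSet_Ioi

theorem fracKernel_mul_fracKernel_sub (a b u : ℝ) :
    (fun r => fracKernel a r * fracKernel b (u - r)) =
      (Set.Ioo 0 u).indicator fun r => r ^ (a - 1) * (u - r) ^ (b - 1) := by
  ext r
  simp only [fracKernel, Set.indicator_apply, Set.mem_Ioi, Set.mem_Ioo, sub_pos]
  split_ifs <;> simp_all

theorem integral_fracKernel_mul_sub {a b : ℝ} (ha : 0 < a) (hb : 0 < b) (u : ℝ) :
    Integrable (fun r => fracKernel a r * fracKernel b (u - r)) ∧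
      ∫ r, fracKernel a r * fracKernel b (u - r) =
        ProbabilityTheory.beta a b * fracKernel (a + b) u := by
  rw [fracKernel_mul_fracKernel_sub]
  rcases le_or_gt u 0 with hu | hu
  · rw [Set.Ioo_eq_empty (by simpa using hu)]
    simp [fracKernel, hu]
  · have h := integral_rpow_mul_sub_rpow ha hb hu
    have hpos : 0 < u ^ (a + b - 1) * ProbabilityTheory.beta a b :=
      mul_pos (Real.rpow_pos_of_pos hu _) (ProbabilityTheory.beta_pos ha hb)
    rw [intervalIntegral.integral_of_le hu.le, integral_Ioc_eq_integral_Ioo] at h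
    refine ⟨?_, ?_⟩
    · rw [integrable_indicator_iff measurableSet_Ioo]
      exact Integrable.of_integral_ne_zero (by rw [h]; exact hpos.ne')
    · rw [integral_indicator measurableSet_Ioo, h, fracKernel, Set.indicator_of_mem (Set.mem_Ioi.2 hu),
        mul_comm]

/-- Put `u = r + t` and exchange integrals: the convolution of two fractional kernels is the Beta
function times the kernel of order `a + b`. -/
theorem integral_integral_rpow_mul_rpow {a b : ℝ} (ha : 0 < a) (hb : 0 < b) {Ψ : ℝ → ℝ}
    (hΨ : Measurable Ψ) (hint : IntegrableOn (fun u => u ^ (a + b - 1) * Ψ u) (Set.Ioi 0)) :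
    ∫ r in Set.Ioi (0 : ℝ), ∫ t in Set.Ioi (0 : ℝ), r ^ (a - 1) * t ^ (b - 1) * Ψ (r + t) =
      ProbabilityTheory.beta a b * ∫ u in Set.Ioi (0 : ℝ), u ^ (a + b - 1) * Ψ u := by
  have hB := (ProbabilityTheory.beta_pos ha hb).le
  have hint' : Integrable fun u => fracKernel (a + b) u * Ψ u := by
    rw [← integrable_indicator_iff measurableSet_Ioi] at hint
    refine hint.congr (ae_of_all _ fun u => ?_)
    simp only [fracKernel, Set.indicator_apply]
    split_ifs <;> simp
  have hFm : Measurable fun q : ℝ × ℝ => fracKernel a q.1 * fracKernel b (q.2 - q.1) * Ψ q.2 :=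
    (((measurable_fracKernel a).comp measurable_fst).mul
      ((measurable_fracKernel b).comp (measurable_snd.sub measurable_fst))).mul
      (hΨ.comp measurable_snd)
  have hF : Integrable (Function.uncurry fun r u : ℝ =>
      fracKernel a r * fracKernel b (u - r) * Ψ u) (volume.prod volume) := by
    refine (integrable_prod_iff' hFm.aestronglyMeasurable).2 ⟨ae_of_all _ fun u => ?_, ?_⟩
    · exact (integral_fracKernel_mul_sub ha hb u).1.mul_const (Ψ u)
    · refine (hint'.norm.const_mul (ProbabilityTheory.beta a b)).congr (ae_of_all _ fun u => ?_)
      have e : ∀ r, ‖fracKernel a r * fracKernel b (u - r) * Ψ u‖ =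
          fracKernel a r * fracKernel b (u - r) * ‖Ψ u‖ := fun r => by
        rw [norm_mul, Real.norm_of_nonneg (mul_nonneg (fracKernel_nonneg _ _)
          (fracKernel_nonneg _ _))]
      simp_rw [e]
      rw [integral_mul_const, (integral_fracKernel_mul_sub ha hb u).2, norm_mul,
        Real.norm_of_nonneg (fracKernel_nonneg _ _), mul_assoc]
  have hind : ∀ (c : ℝ) (f : ℝ → ℝ), ∫ r in Set.Ioi (0 : ℝ), r ^ (c - 1) * f r =
      ∫ r, fracKernel c r * f r := by
    intro c f
    rw [← integral_indicator measurableSet_Ioi]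
    congr 1
    ext r
    simp only [fracKernel, Set.indicator_apply]
    split_ifs <;> simp
  calc ∫ r in Set.Ioi (0 : ℝ), ∫ t in Set.Ioi (0 : ℝ), r ^ (a - 1) * t ^ (b - 1) * Ψ (r + t)
      = ∫ r, fracKernel a r * ∫ t, fracKernel b t * Ψ (r + t) := by
        rw [← hind]
        congr 1
        ext r
        rw [← hind, ← integral_const_mul]
        simp only [mul_assoc]
    _ = ∫ r, ∫ u, fracKernel a r * fracKernel b (u - r) * Ψ u := by
        congr 1
        ext r
        rw [← integral_sub_right_eq_self (fun t => fracKernel b t * Ψ (r + t)) r,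
          ← integral_const_mul]
        simp only [add_sub_cancel, mul_assoc]
    _ = ∫ u, ∫ r, fracKernel a r * fracKernel b (u - r) * Ψ u := integral_integral_swap hF
    _ = ∫ u, ProbabilityTheory.beta a b * (fracKernel (a + b) u * Ψ u) := by
        congr 1
        ext u
        rw [integral_mul_const, (integral_fracKernel_mul_sub ha hb u).2, mul_assoc]
    _ = _ := by rw [integral_const_mul, hind]

/-! ### The Gaussian as a Riesz potential -/

/-- Up to a constant factor, the fractional Laplacian of order `2 (k - b)` of the Gaussian
`exp (-‖x‖ ^ 2)`, for `0 < b < k`. -/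
def gaussianFracLap (n k : ℕ) (b : ℝ) (x : Euc n) : ℝ :=
  ∫ t in Set.Ioi (0 : ℝ), t ^ (b - 1) * heatDeriv (n / 2) k (‖x‖ ^ 2) (1 + t)

theorem measurable_fracLap_integrand (n k : ℕ) (b : ℝ) :
    Measurable fun q : Euc n × ℝ => q.2 ^ (b - 1) * heatDeriv (n / 2) k (‖q.1‖ ^ 2) (1 + q.2) :=
  (measurable_snd.pow_const _).mul ((measurable_heatDeriv _ k).comp
    ((measurable_fst.norm.pow_const 2).prodMk (measurable_snd.const_add 1)))

/-- The bound decouples `r` and `t`, so against `r ^ (a - 1) * t ^ (b - 1)` it is integrable when `0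
< a < n / 2` and `0 < b < k`. This justifies the exchange of integrals below. -/
theorem exists_integral_abs_heat_mul_heatDeriv_le (n k : ℕ) :
    ∃ C : ℝ, 0 ≤ C ∧ ∀ (x : Euc n) (r t : ℝ), 0 < r → 0 < t →
      ∫ y : Euc n, ‖heatDeriv (n / 2) 0 (‖x - y‖ ^ 2) r * heatDeriv (n / 2) k (‖y‖ ^ 2) (1 + t)‖ ≤
        C * ((1 + r) ^ (-((n : ℝ) / 2)) * (1 + t) ^ (-(k : ℝ))) := by
  obtain ⟨C, hC0, hC⟩ := exists_abs_heatDeriv_le (n / 2) k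
  refine ⟨C * Real.pi ^ ((n : ℝ) / 2), by positivity, fun x r t hr ht => ?_⟩
  have ht1 : 0 < 1 + t := by positivity
  calc _ ≤ ∫ y : Euc n, C * (1 + t) ^ (-(k : ℝ)) * (heatDeriv (n / 2) 0 (‖x - y‖ ^ 2) r *
          heatDeriv (n / 2) 0 (‖y‖ ^ 2) (2 * (1 + t))) := by
        refine integral_mono (integrable_heat_mul_heatDeriv x k hr ht1).norm
          ((integrable_heat_mul_heatDeriv x 0 hr (by positivity)).const_mul _) fun y => ?_
        simp only [norm_mul]
        rw [Real.norm_of_nonneg (heatDeriv_zero_nonneg hr), mul_left_comm]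
        exact mul_le_mul_of_nonneg_left (hC _ _ (by positivity) ht1) (heatDeriv_zero_nonneg hr)
    _ = C * (1 + t) ^ (-(k : ℝ)) * (Real.pi ^ ((n : ℝ) / 2) *
          heatDeriv (n / 2) 0 (‖x‖ ^ 2) (r + 2 * (1 + t))) := by
        rw [integral_const_mul, integral_heat_mul_heat x hr (by positivity)]
    _ ≤ C * (1 + t) ^ (-(k : ℝ)) * (Real.pi ^ ((n : ℝ) / 2) * (1 + r) ^ (-((n : ℝ) / 2))) := by
        gcongr
        refine (heatDeriv_zero_le (by positivity) (by positivity)).trans ?_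
        exact Real.rpow_le_rpow_of_nonpos (by positivity) (by linarith) (neg_nonpos.2 (by positivity))
    _ = _ := by ring

/-- The Riesz potential of order `2 a` of `gaussianFracLap` is a multiple of the Gaussian. -/
theorem riesz_integral_gaussianFracLap {n : ℕ} (hn : 0 < n) {a b : ℝ} (ha : 0 < a)
    (han : a < (n : ℝ) / 2) (hb : 0 < b) {j : ℕ} (hab : a + b = (j : ℝ) + 1) (x : Euc n) :
    Real.Gamma ((n : ℝ) / 2 - a) *
      ∫ y, ‖x - y‖ ^ (2 * a - (n : ℝ)) * gaussianFracLap n (j + 1) b y =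
    Real.pi ^ ((n : ℝ) / 2) * (ProbabilityTheory.beta a b *
      ((-1) ^ (j + 1) * j.factorial * Real.exp (-‖x‖ ^ 2))) := by
  have hm : 0 < (n : ℝ) / 2 := by positivity
  set ν : Measure ℝ := volume.restrict (Set.Ioi 0) with hν
  set F : Euc n → ℝ × ℝ → ℝ := fun y z =>
    (z.1 ^ (a - 1) * heatDeriv (n / 2) 0 (‖x - y‖ ^ 2) z.1) *
      (z.2 ^ (b - 1) * heatDeriv (n / 2) (j + 1) (‖y‖ ^ 2) (1 + z.2)) with hF
  have hFm : Measurable (Function.uncurry F) := by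
    have h1 : Measurable fun q : Euc n × ℝ × ℝ =>
        q.2.1 ^ (a - 1) * heatDeriv (n / 2) 0 (‖x - q.1‖ ^ 2) q.2.1 :=
      ((measurable_fst.comp measurable_snd).pow_const _).mul ((measurable_heatDeriv _ 0).comp
        (((measurable_fst.const_sub x).norm.pow_const 2).prodMk (measurable_fst.comp measurable_snd)))
    exact h1.mul ((measurable_fracLap_integrand n (j + 1) b).comp
      (measurable_fst.prodMk (measurable_snd.comp measurable_snd)))
  have hFeq : ∀ (z : ℝ × ℝ) (y : Euc n), F y z = z.1 ^ (a - 1) * z.2 ^ (b - 1) *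
      (heatDeriv (n / 2) 0 (‖x - y‖ ^ 2) z.1 *
        heatDeriv (n / 2) (j + 1) (‖y‖ ^ 2) (1 + z.2)) := by
    intro z y
    rw [hF]
    ring
  have hpos : ∀ᵐ z : ℝ × ℝ ∂ν.prod ν, 0 < z.1 ∧ 0 < z.2 := by
    rw [hν, Measure.prod_restrict]
    filter_upwards [self_mem_ae_restrict (measurableSet_Ioi.prod measurableSet_Ioi)] with z hz
    exact hz
  have hint : Integrable (Function.uncurry F) (volume.prod (ν.prod ν)) := by
    refine (integrable_prod_iff' hFm.aestronglyMeasurable).2 ⟨?_, ?_⟩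
    · filter_upwards [hpos] with z hz
      simp only [Function.uncurry, hFeq]
      exact (integrable_heat_mul_heatDeriv x (j + 1) hz.1 (by linarith [hz.2])).const_mul _
    · obtain ⟨C, hC0, hC⟩ := exists_integral_abs_heat_mul_heatDeriv_le n (j + 1)
      have h1 : Integrable (fun r : ℝ => r ^ (a - 1) * (1 + r) ^ (-((n : ℝ) / 2))) ν :=
        integrableOn_rpow_mul_one_add_rpow ha han
      have h2 : Integrable (fun t : ℝ => t ^ (b - 1) * (1 + t) ^ (-((j + 1 : ℕ) : ℝ))) ν :=
        integrableOn_rpow_mul_one_add_rpow hb (by push_cast; linarith)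
      refine Integrable.mono' ((h1.mul_prod h2).const_mul C)
        hFm.aestronglyMeasurable.norm.prod_swap.integral_prod_right' ?_
      filter_upwards [hpos] with z hz
      rw [Real.norm_of_nonneg (integral_nonneg fun y => norm_nonneg _)]
      have hz1 := hz.1
      have hz2 := hz.2
      have e : ∀ y, ‖Function.uncurry F (y, z)‖ = z.1 ^ (a - 1) * z.2 ^ (b - 1) *
          ‖heatDeriv (n / 2) 0 (‖x - y‖ ^ 2) z.1 *
            heatDeriv (n / 2) (j + 1) (‖y‖ ^ 2) (1 + z.2)‖ := by
        intro y
        simp only [Function.uncurry, hFeq]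
        rw [norm_mul, Real.norm_of_nonneg (by positivity)]
      simp_rw [e]
      rw [integral_const_mul]
      calc _ ≤ z.1 ^ (a - 1) * z.2 ^ (b - 1) * _ :=
            mul_le_mul_of_nonneg_left (hC x z.1 z.2 hz1 hz2) (by positivity)
        _ = _ := by ring
  have hinner : ∀ᵐ z : ℝ × ℝ ∂ν.prod ν, ∫ y, F y z = z.1 ^ (a - 1) * z.2 ^ (b - 1) *
      (Real.pi ^ ((n : ℝ) / 2) * heatDeriv (n / 2) (j + 1) (‖x‖ ^ 2) (1 + (z.1 + z.2))) := by
    filter_upwards [hpos] with z hz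
    simp_rw [hFeq]
    rw [integral_const_mul, integral_heat_mul_heatDeriv x (j + 1) hz.1 (by linarith [hz.2])]
    congr 3
    ring
  have hpow : ∀ u : ℝ, u ^ (a + b - 1) = u ^ j := fun u => by
    rw [hab, add_sub_cancel_right, Real.rpow_natCast]
  have := Nonempty.intro (⟨0, hn⟩ : Fin n)
  -- Expand the Riesz kernel in heat kernels of time `r`, exchange, and apply the semigroup law;
  -- only `r + t` then matters. Since `a + b = j + 1` is an integer, merging the two fractional
  -- integrals leaves `u ^ j`, which integration by parts evaluates.
  calc Real.Gamma ((n : ℝ) / 2 - a) *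
        ∫ y, ‖x - y‖ ^ (2 * a - (n : ℝ)) * gaussianFracLap n (j + 1) b y
      = ∫ y, (∫ z, F y z ∂ν.prod ν) := by
        rw [← integral_const_mul]
        refine integral_congr_ae ?_
        filter_upwards [Measure.ae_ne volume x] with y hy
        have hxy : 0 < ‖x - y‖ := norm_pos_iff.2 (sub_ne_zero.2 (Ne.symm hy))
        rw [integral_prod_mul (fun r : ℝ => r ^ (a - 1) * heatDeriv (n / 2) 0 (‖x - y‖ ^ 2) r)
          (fun t : ℝ => t ^ (b - 1) * heatDeriv (n / 2) (j + 1) (‖y‖ ^ 2) (1 + t)),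
          integral_Ioi_rpow_mul_heatDeriv han (by positivity), gaussianFracLap]
        have : (‖x - y‖ ^ 2) ^ (a - (n : ℝ) / 2) = ‖x - y‖ ^ (2 * a - (n : ℝ)) := by
          rw [← Real.rpow_natCast, ← Real.rpow_mul hxy.le]
          congr 1
          push_cast
          ring
        rw [this]
        ring
    _ = ∫ z, (∫ y, F y z) ∂ν.prod ν := integral_integral_swap hint
    _ = ∫ z, z.1 ^ (a - 1) * z.2 ^ (b - 1) * (Real.pi ^ ((n : ℝ) / 2) *
          heatDeriv (n / 2) (j + 1) (‖x‖ ^ 2) (1 + (z.1 + z.2))) ∂ν.prod ν :=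
        integral_congr_ae hinner
    _ = ∫ r in Set.Ioi (0 : ℝ), ∫ t in Set.Ioi (0 : ℝ), r ^ (a - 1) * t ^ (b - 1) *
          (Real.pi ^ ((n : ℝ) / 2) * heatDeriv (n / 2) (j + 1) (‖x‖ ^ 2) (1 + (r + t))) :=
        integral_prod _ (hint.integral_prod_right.congr hinner)
    _ = ProbabilityTheory.beta a b * ∫ u in Set.Ioi (0 : ℝ), u ^ (a + b - 1) *
          (Real.pi ^ ((n : ℝ) / 2) * heatDeriv (n / 2) (j + 1) (‖x‖ ^ 2) (1 + u)) := by
        refine integral_integral_rpow_mul_rpow ha hb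
          (Ψ := fun u => Real.pi ^ ((n : ℝ) / 2) * heatDeriv (n / 2) (j + 1) (‖x‖ ^ 2) (1 + u))
          (((measurable_heatDeriv _ _).comp
            (measurable_const.prodMk (measurable_id.const_add 1))).const_mul _) ?_
        have h1 := integrableOn_rpow_mul_heatDeriv (m := (n : ℝ) / 2) (j + 1) (i := a + b)
          (by positivity) (by push_cast; linarith) (ρ := ‖x‖ ^ 2) (by positivity)
        refine IntegrableOn.congr_fun (h1.const_mul (Real.pi ^ ((n : ℝ) / 2))) (fun u _ => ?_)
          measurableSet_Ioi
        ring
    _ = _ := by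
        have e : ∀ u : ℝ, u ^ (a + b - 1) * (Real.pi ^ ((n : ℝ) / 2) *
            heatDeriv (n / 2) (j + 1) (‖x‖ ^ 2) (1 + u)) = Real.pi ^ ((n : ℝ) / 2) *
            (u ^ j * heatDeriv (n / 2) (j + 1) (‖x‖ ^ 2) (1 + u)) := fun u => by
          rw [hpow]
          ring
        simp_rw [e]
        rw [integral_const_mul, integral_pow_mul_heatDeriv hm (by positivity), heatDeriv_zero,
          Real.one_rpow, div_one, one_mul]
        ring

/-- The function is bounded by some `M` and integrable, so its `p`-th power is at most `M ^ (p - 1)`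
times its absolute value. -/
theorem memLp_gaussianFracLap {n : ℕ} {k : ℕ} {b : ℝ} (hb : 0 < b) (hbk : b < k) {p : ℝ}
    (hp : 1 < p) : MemLp (gaussianFracLap n k b) (ENNReal.ofReal p) := by
  have hp0 : 0 < p := by linarith
  set ν : Measure ℝ := volume.restrict (Set.Ioi 0) with hν
  obtain ⟨C, hC0, hC⟩ := exists_abs_heatDeriv_le (n / 2) k
  have hk : Integrable (fun t : ℝ => t ^ (b - 1) * (1 + t) ^ (-(k : ℝ))) ν :=
    integrableOn_rpow_mul_one_add_rpow hb hbk
  have hpos : ∀ᵐ t : ℝ ∂ν, 0 < t := self_mem_ae_restrict measurableSet_Ioi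
  have hpt : ∀ (x : Euc n) (t : ℝ), 0 < t →
      ‖t ^ (b - 1) * heatDeriv (n / 2) k (‖x‖ ^ 2) (1 + t)‖ ≤
        C * (t ^ (b - 1) * (1 + t) ^ (-(k : ℝ))) * heatDeriv (n / 2) 0 (‖x‖ ^ 2) (2 * (1 + t)) := by
    intro x t ht
    rw [norm_mul, Real.norm_of_nonneg (by positivity)]
    calc _ ≤ t ^ (b - 1) * _ :=
          mul_le_mul_of_nonneg_left (hC (‖x‖ ^ 2) (1 + t) (by positivity) (by positivity))
            (by positivity)
      _ = _ := by ring
  have hbdd : ∀ x : Euc n, ‖gaussianFracLap n k b x‖ ≤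
      ∫ t, C * (t ^ (b - 1) * (1 + t) ^ (-(k : ℝ))) ∂ν := by
    intro x
    refine norm_integral_le_of_norm_le (hk.const_mul C) ?_
    filter_upwards [hpos] with t ht
    refine (hpt x t ht).trans (mul_le_of_le_one_right (by positivity) ?_)
    refine (heatDeriv_zero_le (by positivity) (by positivity)).trans ?_
    exact Real.rpow_le_one_of_one_le_of_nonpos (by linarith) (neg_nonpos.2 (by positivity))
  have hfm := measurable_fracLap_integrand n k b
  have hint : Integrable (fun q : Euc n × ℝ =>
      q.2 ^ (b - 1) * heatDeriv (n / 2) k (‖q.1‖ ^ 2) (1 + q.2)) (volume.prod ν) := by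
    have hdom : ∀ t : ℝ, 0 < t → Integrable fun x : Euc n =>
        C * (t ^ (b - 1) * (1 + t) ^ (-(k : ℝ))) * heatDeriv (n / 2) 0 (‖x‖ ^ 2) (2 * (1 + t)) :=
      fun t ht => (integrable_heatDeriv_zero (by positivity)).const_mul _
    have hx : ∀ t : ℝ, 0 < t → Integrable fun x : Euc n =>
        t ^ (b - 1) * heatDeriv (n / 2) k (‖x‖ ^ 2) (1 + t) := fun t ht =>
      (hdom t ht).mono' (hfm.comp (measurable_id.prodMk measurable_const)).aestronglyMeasurable
        (ae_of_all _ fun x => hpt x t ht)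
    refine (integrable_prod_iff' hfm.aestronglyMeasurable).2 ⟨?_, ?_⟩
    · filter_upwards [hpos] with t ht
      exact hx t ht
    · refine Integrable.mono' ((hk.const_mul C).mul_const (Real.pi ^ ((n : ℝ) / 2)))
        hfm.aestronglyMeasurable.norm.prod_swap.integral_prod_right' ?_
      filter_upwards [hpos] with t ht
      rw [Real.norm_of_nonneg (integral_nonneg fun y => norm_nonneg _)]
      refine (integral_mono (hx t ht).norm (hdom t ht) fun x => hpt x t ht).trans_eq ?_
      rw [integral_const_mul, integral_heatDeriv_zero (by positivity)]
  have hg : Integrable (gaussianFracLap n k b) := hint.integral_prod_left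
  set M := ∫ t, C * (t ^ (b - 1) * (1 + t) ^ (-(k : ℝ))) ∂ν with hM
  rw [← integrable_norm_rpow_iff hg.1 (by simpa using hp0) ENNReal.ofReal_ne_top,
    ENNReal.toReal_ofReal hp0.le]
  refine (hg.norm.const_mul (M ^ (p - 1))).mono'
    (hg.1.norm.aemeasurable.pow_const p).aestronglyMeasurable (ae_of_all _ fun x => ?_)
  rw [Real.norm_of_nonneg (by positivity)]
  have h1 : ‖gaussianFracLap n k b x‖ ^ p =
      ‖gaussianFracLap n k b x‖ ^ (p - 1) * ‖gaussianFracLap n k b x‖ := by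
    conv_rhs => rw [← Real.rpow_one (‖gaussianFracLap n k b x‖), ← Real.rpow_mul (norm_nonneg _),
      one_mul]
    rw [← Real.rpow_add_of_nonneg (norm_nonneg _) (by linarith) zero_le_one]
    congr 1
    ring
  rw [h1]
  gcongr
  exact hbdd x

theorem exists_rieszPotential_eq_gaussian {n : ℕ} (hn : 0 < n) {α p : ℝ} (hα : 0 < α)
    (hαn : α < n) (hp : 1 < p) :
    ∃ g : Euc n → ℝ, MemLp g (ENNReal.ofReal p) ∧
      ∀ x, rieszPotential α g x = Real.exp (-‖x‖ ^ 2) := by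
  set a := α / 2 with ha
  have ha0 : 0 < a := by positivity
  -- `j + 1` is the least integer above `a = α / 2`, so `b = j + 1 - a` is positive and `a + b` is
  -- an integer.
  set j := ⌊a⌋₊ with hj
  have hja : a < (j : ℝ) + 1 := Nat.lt_floor_add_one a
  set b := (j : ℝ) + 1 - a with hb
  have hb0 : 0 < b := by linarith
  have han : a < (n : ℝ) / 2 := by linarith
  have hkey := riesz_integral_gaussianFracLap hn ha0 han hb0 (j := j) (by rw [hb]; ring)
  have hΓ : 0 < Real.Gamma ((n : ℝ) / 2 - a) := Real.Gamma_pos_of_pos (by linarith)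
  have hΓ2 : 0 < Real.Gamma (((n : ℝ) - α) / 2) := Real.Gamma_pos_of_pos (by linarith)
  have hΓ3 : 0 < Real.Gamma (α / 2) := Real.Gamma_pos_of_pos ha0
  have hc : rieszConst n α ≠ 0 := by
    rw [rieszConst]
    have := Real.pi_pos
    positivity
  set κ : ℝ := Real.pi ^ ((n : ℝ) / 2) * (ProbabilityTheory.beta a b *
    ((-1) ^ (j + 1) * j.factorial)) with hκ
  have hκ0 : κ ≠ 0 := by
    have h1 := (Real.rpow_pos_of_pos Real.pi_pos ((n : ℝ) / 2)).ne'
    have h2 := (ProbabilityTheory.beta_pos ha0 hb0).ne'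
    have h3 : ((-1 : ℝ) ^ (j + 1)) ≠ 0 := pow_ne_zero _ (by norm_num)
    have h4 : (j.factorial : ℝ) ≠ 0 := by positivity
    exact mul_ne_zero h1 (mul_ne_zero h2 (mul_ne_zero h3 h4))
  refine ⟨fun x => (Real.Gamma ((n : ℝ) / 2 - a) / (rieszConst n α * κ)) *
    gaussianFracLap n (j + 1) b x, ?_, fun x => ?_⟩
  · exact (memLp_gaussianFracLap hb0 (by push_cast; linarith) hp).const_mul _
  · have h2a : α - (n : ℝ) = 2 * a - n := by rw [ha]; ring
    rw [rieszPotential, h2a]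
    simp_rw [mul_left_comm _ (Real.Gamma ((n : ℝ) / 2 - a) / (rieszConst n α * κ))]
    rw [integral_const_mul]
    have h := hkey x
    calc _ = (Real.Gamma ((n : ℝ) / 2 - a) *
          ∫ y, ‖x - y‖ ^ (2 * a - (n : ℝ)) * gaussianFracLap n (j + 1) b y) / κ := by
          field_simp
      _ = (κ * Real.exp (-‖x‖ ^ 2)) / κ := by
          rw [h, hκ]
          ring
      _ = _ := by field_simp

/-! ### Scaling -/

theorem rieszPotential_comp_dilation {n : ℕ} {α : ℝ} (g : Euc n → ℝ) (x₀ : Euc n) {r : ℝ}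
    (hr : 0 < r) (c : ℝ) (x : Euc n) :
    rieszPotential α (fun y => c * r ^ (-α) * g (r⁻¹ • (y - x₀))) x =
      c * rieszPotential α g (r⁻¹ • (x - x₀)) := by
  set h : Euc n → ℝ := fun w => ‖r⁻¹ • (x - x₀) - w‖ ^ (α - (n : ℝ)) * g w with hh
  have e : ∀ y : Euc n, ‖x - y‖ ^ (α - (n : ℝ)) * (c * r ^ (-α) * g (r⁻¹ • (y - x₀))) =
      c * r ^ (-(n : ℝ)) * h (r⁻¹ • (y - x₀)) := by
    intro y
    have h1 : ‖x - y‖ = r * ‖r⁻¹ • (x - x₀) - r⁻¹ • (y - x₀)‖ := by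
      rw [← smul_sub, norm_smul, norm_inv, Real.norm_of_nonneg hr.le, mul_inv_cancel_left₀ hr.ne']
      congr 1
      abel
    have h2 : r ^ (α - (n : ℝ)) * r ^ (-α) = r ^ (-(n : ℝ)) := by
      rw [← Real.rpow_add hr]
      congr 1
      ring
    rw [hh, h1, Real.mul_rpow hr.le (norm_nonneg _), ← h2]
    ring
  rw [rieszPotential, rieszPotential]
  simp_rw [e]
  rw [integral_const_mul, integral_sub_right_eq_self (fun y => h (r⁻¹ • y)) x₀,
    Measure.integral_comp_inv_smul_of_nonneg _ _ hr.le, finrank_euclideanSpace_fin, smul_eq_mul,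
    Real.rpow_neg hr.le, Real.rpow_natCast]
  have : r ^ n ≠ 0 := by positivity
  change _ = c * (rieszConst n α * ∫ w, h w)
  field_simp

theorem memLp_comp_dilation {n : ℕ} {p : ℝ} (hp : 0 < p) {g : Euc n → ℝ}
    (hg : MemLp g (ENNReal.ofReal p)) (x₀ : Euc n) {r : ℝ} (hr : 0 < r) (c : ℝ) :
    MemLp (fun y => c * g (r⁻¹ • (y - x₀))) (ENNReal.ofReal p) ∧
      eLpNorm (fun y => c * g (r⁻¹ • (y - x₀))) (ENNReal.ofReal p) volume ^ p =
        ENNReal.ofReal (|c| ^ p * r ^ (n : ℝ)) * eLpNorm g (ENNReal.ofReal p) volume ^ p := by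
  have hmap : Measure.map (fun y : Euc n => r⁻¹ • y) volume =
      ENNReal.ofReal (r ^ (n : ℝ)) • (volume : Measure (Euc n)) := by
    rw [Measure.map_addHaar_smul _ (inv_ne_zero hr.ne'), finrank_euclideanSpace_fin, inv_pow,
      inv_inv, abs_of_pos (by positivity), Real.rpow_natCast]
  have hemb : MeasurableEmbedding fun y : Euc n => r⁻¹ • y :=
    measurableEmbedding_const_smul₀ (inv_ne_zero hr.ne')
  have h1 : MemLp (g ∘ fun y : Euc n => r⁻¹ • y) (ENNReal.ofReal p) := by
    rw [← hemb.memLp_map_measure_iff, hmap]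
    exact hg.smul_measure ENNReal.ofReal_ne_top
  have h2 : eLpNorm (g ∘ fun y : Euc n => r⁻¹ • y) (ENNReal.ofReal p) volume =
      ENNReal.ofReal (r ^ (n : ℝ)) ^ (1 / p) * eLpNorm g (ENNReal.ofReal p) volume := by
    rw [← hemb.eLpNorm_map_measure, hmap, eLpNorm_smul_measure_of_ne_top ENNReal.ofReal_ne_top,
      smul_eq_mul, one_div, ENNReal.toReal_inv, ENNReal.toReal_ofReal hp.le, one_div]
  have hmp : MeasurePreserving (fun y : Euc n => y - x₀) volume volume :=
    measurePreserving_sub_right volume x₀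
  refine ⟨(h1.comp_measurePreserving hmp).const_mul c, ?_⟩
  have h3 : eLpNorm (fun y => c * g (r⁻¹ • (y - x₀))) (ENNReal.ofReal p) volume =
      ‖c‖ₑ * eLpNorm (g ∘ fun y : Euc n => r⁻¹ • y) (ENNReal.ofReal p) volume := by
    rw [← eLpNorm_comp_measurePreserving h1.1 hmp, ← eLpNorm_const_smul]
    rfl
  rw [h3, h2, ENNReal.mul_rpow_of_nonneg _ _ hp.le, ENNReal.mul_rpow_of_nonneg _ _ hp.le,
    ← ENNReal.rpow_mul, one_div_mul_cancel hp.ne', ENNReal.rpow_one, ← mul_assoc,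
    ENNReal.ofReal_mul (by positivity), ← ofReal_norm, Real.norm_eq_abs,
    ENNReal.ofReal_rpow_of_nonneg (abs_nonneg c) hp.le]

/-- The test function is a dilated Gaussian times `e`, which is at least `1` on the ball. Its
density is the dilated `g` times `e * r ^ (-α)`, so the `p`-th power of the norm scales like `r ^ (n
- α p)`. -/
theorem exists_rieszCap_ball_le {n : ℕ} (hn : 0 < n) {α p : ℝ} (hα : 0 < α) (hαn : α < n)
    (hp : 1 < p) : ∃ K : ℝ≥0, ∀ (x : Euc n) (r : ℝ≥0), 0 < r →
      rieszCap α p (Metric.ball x (r : ℝ)) ≤ K * (r : ℝ≥0∞) ^ ((n : ℝ) - α * p) := by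
  have hp0 : 0 < p := by linarith
  obtain ⟨g, hg, hgG⟩ := exists_rieszPotential_eq_gaussian hn hα hαn hp
  set N := eLpNorm g (ENNReal.ofReal p) volume ^ p with hN
  have hNt : N ≠ ∞ := ENNReal.rpow_ne_top_of_nonneg hp0.le hg.2.ne
  refine ⟨(Real.exp 1 ^ p).toNNReal * N.toNNReal, fun x₀ r hr => ?_⟩
  have hr0 : (0 : ℝ) < r := hr
  set f : 𝓢(Euc n, ℝ) := Real.exp 1 • SchwartzMap.compSubConstCLM ℝ x₀
    (SchwartzMap.compCLMOfContinuousLinearEquiv ℝ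
      (ContinuousLinearEquiv.smulLeft (Units.mk0 (r : ℝ)⁻¹ (inv_ne_zero hr0.ne')))
      (gaussianSchwartz (Euc n))) with hf
  have hfx : ∀ x, f x = Real.exp 1 * Real.exp (-‖(r : ℝ)⁻¹ • (x - x₀)‖ ^ 2) := fun x => rfl
  obtain ⟨hmem, hnorm⟩ := memLp_comp_dilation hp0 hg x₀ hr0 (Real.exp 1 * (r : ℝ) ^ (-α))
  refine (iInf_le _ f).trans ((iInf_le _ fun x => ?_).trans ((iInf_le _ fun x hx => ?_).trans ?_))
  · rw [hfx]
    positivity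
  · rw [hfx, ← Real.exp_add]
    refine Real.one_le_exp ?_
    rw [norm_smul, norm_inv, Real.norm_of_nonneg hr0.le, ← dist_eq_norm]
    have h1 : (r : ℝ)⁻¹ * dist x x₀ ≤ 1 := by
      rw [inv_mul_le_iff₀ hr0, mul_one]
      exact hx.le
    have h2 : 0 ≤ (r : ℝ)⁻¹ * dist x x₀ := by positivity
    nlinarith
  · have h1 : rieszNorm α p f ≤
        eLpNorm (fun y => Real.exp 1 * (r : ℝ) ^ (-α) * g ((r : ℝ)⁻¹ • (y - x₀)))
          (ENNReal.ofReal p) volume := by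
      refine (iInf_le _ _).trans ((iInf_le _ hmem).trans (iInf_le _ (ae_of_all _ fun x => ?_)))
      rw [rieszPotential_comp_dilation g x₀ hr0, hgG, hfx]
    refine (ENNReal.rpow_le_rpow h1 hp0.le).trans_eq ?_
    rw [hnorm, ← hN, abs_of_pos (by positivity), Real.mul_rpow (by positivity) (by positivity),
      ← Real.rpow_mul hr0.le, mul_assoc, ← Real.rpow_add hr0, ENNReal.ofReal_mul (by positivity),
      ENNReal.coe_mul, ENNReal.coe_toNNReal hNt, ← ENNReal.ofReal_rpow_of_pos hr0,
      ENNReal.ofReal_coe_nnreal]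
    have : -α * p + n = (n : ℝ) - α * p := by ring
    rw [this]
    change ENNReal.ofReal _ * _ * _ = ENNReal.ofReal _ * _ * _
    ring

/-! ### Comparison of the three classes -/

theorem exists_extendTop_le {Φ Φα : ℝ≥0 → ℝ≥0} {d : ℝ} (hd : 0 < d)
    (hΦα : ∀ s, Φα s = Φ (s ^ (1 / d))) {A : ℝ≥0} (hA : ∀ s t, s ≤ t → Φ s ≤ A * Φ t)
    (hdil : ∀ c : ℝ≥0, 0 < c → ∃ C : ℝ≥0, ∀ s, Φ (c * s) ≤ C * Φ s) (K : ℝ≥0) :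
    ∃ C : ℝ≥0, ∀ (cap : ℝ≥0∞) (r : ℝ≥0), cap ≤ K * (r : ℝ≥0∞) ^ d →
      extendTop Φα cap ≤ C * Φ r := by
  -- `K + 1` replaces `K` because the dilation factor must be positive.
  obtain ⟨D, hD⟩ := hdil ((K + 1) ^ (1 / d)) (NNReal.rpow_pos (by positivity))
  refine ⟨A * D, fun cap r hcap => ?_⟩
  have hcap' : cap ≤ (((K + 1) * r ^ d : ℝ≥0) : ℝ≥0∞) := by
    rw [ENNReal.coe_mul, ENNReal.coe_rpow_of_nonneg _ hd.le]
    refine hcap.trans ?_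
    gcongr
    simp
  lift cap to ℝ≥0 using (hcap'.trans_lt ENNReal.coe_lt_top).ne
  rw [ENNReal.coe_le_coe] at hcap'
  simp only [extendTop, ENNReal.coe_ne_top, if_false, ENNReal.toNNReal_coe, hΦα]
  rw [← ENNReal.coe_mul, ENNReal.coe_le_coe]
  have h1 : cap ^ (1 / d) ≤ (K + 1) ^ (1 / d) * r := by
    calc cap ^ (1 / d) ≤ ((K + 1) * r ^ d) ^ (1 / d) := by gcongr
      _ = _ := by
        rw [NNReal.mul_rpow, ← NNReal.rpow_mul, mul_one_div_cancel hd.ne', NNReal.rpow_one]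
  calc Φ (cap ^ (1 / d)) ≤ A * Φ ((K + 1) ^ (1 / d) * r) := hA _ _ h1
    _ ≤ A * (D * Φ r) := by gcongr; exact hD r
    _ = _ := by ring

theorem capClass_subset_carlesonClass {n : ℕ} {Φ Φα : ℝ≥0 → ℝ≥0} {d : ℝ} (hd : 0 < d)
    (hΦα : ∀ s, Φα s = Φ (s ^ (1 / d))) {A : ℝ≥0} (hA : ∀ s t, s ≤ t → Φ s ≤ A * Φ t)
    (hdil : ∀ c : ℝ≥0, 0 < c → ∃ C : ℝ≥0, ∀ s, Φ (c * s) ≤ C * Φ s)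
    {cap : Set (Euc n) → ℝ≥0∞} {K : ℝ≥0} (hK : ∀ (x : Euc n) (r : ℝ≥0), 0 < r →
      cap (Metric.ball x (r : ℝ)) ≤ K * (r : ℝ≥0∞) ^ d) :
    capClass Φα cap ⊆ carlesonClass Φ := by
  rintro μ ⟨c, hc⟩
  obtain ⟨C, hC⟩ := exists_extendTop_le hd hΦα hA hdil K
  refine ⟨c * C, fun x r hr => (hc _ Metric.isOpen_ball).trans ?_⟩
  rw [ENNReal.coe_mul, mul_assoc]
  gcongr
  exact hC _ r (hK x r hr)

end CapacityMeasures

end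

theorem mainTheorem6 (n : ℕ) (α p : ℝ) (hα : 0 < α) (hp : 1 < p) (hpn : p < (n : ℝ) / α)
    (Φ : ℝ≥0 → ℝ≥0)
    (hmono : ∃ Φ' : ℝ≥0 → ℝ≥0, StrictMono Φ' ∧ CapacityMeasures.Equivalent Φ Φ')
    (hzero : Φ 0 = 0)
    (hdil : ∀ c : ℝ≥0, 0 < c → CapacityMeasures.Equivalent (fun s => Φ (c * s)) Φ)
    (hint : CapacityMeasures.DiniCondition Φ ((n : ℝ) - α * p) p)
    (Φα : ℝ≥0 → ℝ≥0) (hΦα : ∀ s, Φα s = Φ (s ^ (1 / ((n : ℝ) - α * p)))) :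
    CapacityMeasures.capClass (n := n) Φα
        (CapacityMeasures.hausdorffCap ((n : ℝ) - α * p)) =
      CapacityMeasures.capClass (n := n) Φα (CapacityMeasures.rieszCap α p) ∧
    CapacityMeasures.capClass (n := n) Φα (CapacityMeasures.rieszCap α p) =
      CapacityMeasures.carlesonClass (n := n) Φ := by
  have hpα : p * α < n := (lt_div_iff₀ hα).1 hpn
  have hd : 0 < (n : ℝ) - α * p := by linarith
  have hdn : (n : ℝ) - α * p ≤ n := by
    have : 0 < α * p := by positivity
    linarith
  have hαn : α < n := by nlinarith
  have hn : 0 < n := by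
    have : (0 : ℝ) < n := hα.trans hαn
    exact_mod_cast this
  have hdil' : ∀ c : ℝ≥0, 0 < c → ∃ C : ℝ≥0, ∀ s, Φ (c * s) ≤ C * Φ s := fun c hc => (hdil c hc).1
  obtain ⟨A, hA⟩ := CapacityMeasures.exists_le_mul_of_le hmono
  obtain ⟨B₂, hB₂⟩ := hdil' 2 two_pos
  obtain ⟨B, hB⟩ := hint.almost_increasing hd hp hA hB₂
  have hriesz : CapacityMeasures.capClass (n := n) Φα (CapacityMeasures.rieszCap α p) =
      CapacityMeasures.carlesonClass (n := n) Φ := by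
    obtain ⟨K, hK⟩ := CapacityMeasures.exists_rieszCap_ball_le hn hα hαn hp
    refine Set.Subset.antisymm
      (CapacityMeasures.capClass_subset_carlesonClass hd hΦα hA hdil' hK) fun μ hμ => ?_
    obtain ⟨C, hC⟩ := CapacityMeasures.measure_tent_le_of_rieszCap_lt hn hα hαn hp hd rfl
      hdil' hint hμ
    obtain ⟨C', hC'⟩ := CapacityMeasures.le_extendTop_of_forall hd hΦα hdil' hB C
    exact ⟨C', fun O hO => hC' _ _ fun S hS h => hC O S hO hS h⟩
  have hhaus : CapacityMeasures.capClass (n := n) Φα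
      (CapacityMeasures.hausdorffCap ((n : ℝ) - α * p)) =
      CapacityMeasures.carlesonClass (n := n) Φ := by
    refine Set.Subset.antisymm
      (CapacityMeasures.capClass_subset_carlesonClass (K := 1) hd hΦα hA hdil' fun x r _ => ?_)
      fun μ hμ => ?_
    · rw [ENNReal.coe_one, one_mul]
      exact CapacityMeasures.hausdorffCap_ball_le hd x r
    · obtain ⟨C, hC⟩ := CapacityMeasures.measure_tent_le_of_hausdorffCap_lt hd hdn hzero
        hdil' hB hμ
      obtain ⟨C', hC'⟩ := CapacityMeasures.le_extendTop_of_forall hd hΦα hdil' hB C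
      exact ⟨C', fun O _ => hC' _ _ fun S hS h => hC O S hS h⟩
  exact ⟨hhaus.trans hriesz.symm, hriesz⟩
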